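/- Let $m_1,m_2,m_3>0$. On the space $\mathbb{C}^3$ of located triangles $\mathbf q=(q_1,q_2,q_3)$ use the mass inner product $\langle \mathbf v,\mathbf w\rangle=\sum_i m_i\bar v_i w_i$ with norm $\|\cdot\|$, and let the group $G$ of orientation-preserving isometries of the plane $\mathbb{C}$ act on $\mathbb{C}^3$ by moving all three vertices. Put $$Z_1=\mu_1(q_1-q_2),\quad Z_2=\mu_2\Big(q_3-\frac{m_1q_1+m_2q_2}{m_1+m_2}\Big),\quad \frac1{\mu_1^2}=\frac1{m_1}+\frac1{m_2},\quad \frac1{\mu_2^2}=\frac1{m_3}+\frac1{m_1+m_2}$$ with $\mu_1,\mu_2>0$, and $\pi:\mathbb{C}^3\to\mathbb{R}^3$, $\pi(\mathbf q)=\big(\tfrac12(|Z_1|^2-|Z_2|^2),\ \mathrm{Re}(Z_1\bar Z_2),\ \mathrm{Im}(Z_1\bar Z_2)\big)$. On $\mathbb{R}^3\setminus\{0\}$ consider the Riemannian metric $ds^2=|dw|^2/(2|w|)$. The distance between two points of $\mathbb{R}^3$ is the infimum of the $ds$-lengths of the piecewise $C^1$ paths in $\mathbb{R}^3$ joining them (such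 paths may pass through $0$). A geodesic on an interval $J$ is a curve $\gamma:J\to\mathbb{R}^3$, parametrized by a positive constant multiple of arclength, such that every $t\in J$ has a neighbourhood in $J$ on each compact subinterval of which $\gamma$ is piecewise $C^1$ and its length equals the distance between its endpoints. A horizontal line is a line $t\mapsto \mathbf q+t\mathbf v$ in $\mathbb{C}^3$, $\mathbf v\ne 0$, which at each of its points is orthogonal (for $\mathrm{Re}\langle\cdot,\cdot\rangle$) to the $G$-orbit through that point, i.e. to the real span of $(1,1,1)$, $i(1,1,1)$ and $i$ times that point. Then: 1. $\pi$ is onto and its fibres are exactly the $G$-orbits, so that $\pi$ identifies shape space $\mathbb{C}^3/G$ with $\mathbb{R}^3$. Under this identification the distance of $ds^2$ is the shape space distance: the distance between $\pi(\mathbf q)$ and $\pi(\mathbf q')$ is $\inf_{g,g'\in G}\|g\mathbf q-g'\mathbf q'\|$ for all $\mathbf q,\mathbf q'\in\mathbb{C}^3$. 2. The geodesics are the projections of horizontal lines: a curve $\gamma:J\to\mathbb{R}^3$ on an interval $J$ is a geodesic if and only if there is a horizontal line $\mathbf q+t\mathbf v$ such that $\gamma(t)=\pi(\mathbf q+t\mathbf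 v)$ for all $t\in J$ and $\mathbf q+t\mathbf v$ is not a triple collision (all three vertices equal) for any $t$ in the interior of $J$. 3. Every plane $\Pi=\{Aw_1+Bw_2+Cw_3=0\}$ with $(A,B,C)\neq(0,0,0)$ is totally geodesic: a geodesic on an interval $J$ that at some time $t_0\in J$ is at a point of $\Pi\setminus\{0\}$ with velocity tangent to $\Pi$ lies in $\Pi$ for all $t\in J$. 4. On each such plane let $e_1,e_2$ be a Euclidean orthonormal basis, let $\theta$ be the Euclidean polar angle and let $r=\sqrt{2|w|}$, i.e. $w=\tfrac{r^2}{2}(\cos\theta\,e_1+\sin\theta\,e_2)$. This gives a bijection of $\{r>0,\ 0\le\theta<2\pi\}$ onto $\Pi\setminus\{0\}$, $r$ is the $ds$-distance from $0$ to $w$, and for all $r>0$ and $\theta\in\mathbb{R}$ the restriction of the metric to $\Pi$ is $dr^2+\tfrac14 r^2\,d\theta^2$. -/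

import Mathlib

open Set MeasureTheory
open scoped ENNReal ComplexConjugate

noncomputable section

namespace ShapeSpace

/-- Located triangles: `q i ∈ ℂ` is the position of the `i`-th vertex. -/
abbrev Config : Type := Fin 3 → ℂ

/-- The target `ℝ³` of the shape map, with its Euclidean norm. -/
abbrev W : Type := EuclideanSpace ℝ (Fin 3)

/-- The mass inner product, conjugate-linear in the first slot. -/
def massInner (m : Fin 3 → ℝ) (v w : Config) : ℂ := ∑ i, (m i : ℂ) * conj (v i) * w i

/-- The norm of the mass inner product. -/
def massNorm (m : Fin 3 → ℝ) (v : Config) : ℝ := Real.sqrt (massInner m v v).re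

/-- The group `G` of rigid motions: orientation preserving isometries of the plane `ℂ`. -/
def rigidMotions : Subgroup (ℂ ≃ᵃⁱ[ℝ] ℂ) where
  carrier := {g | 0 < LinearMap.det (g.linearIsometryEquiv.toLinearEquiv : ℂ →ₗ[ℝ] ℂ)}
  one_mem' := by
    have h : ((1 : ℂ ≃ᵃⁱ[ℝ] ℂ).linearIsometryEquiv.toLinearEquiv : ℂ →ₗ[ℝ] ℂ)
        = LinearMap.id := by ext <;> rfl
    simp only [Set.mem_ofPred_eq]
    rw [h, LinearMap.det_id]
    exact one_pos
  mul_mem' := by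
    intro a b ha hb
    have h : ((a * b).linearIsometryEquiv.toLinearEquiv : ℂ →ₗ[ℝ] ℂ)
        = (a.linearIsometryEquiv.toLinearEquiv : ℂ →ₗ[ℝ] ℂ) ∘ₗ
          (b.linearIsometryEquiv.toLinearEquiv : ℂ →ₗ[ℝ] ℂ) := by ext <;> rfl
    simp only [Set.mem_ofPred_eq] at ha hb ⊢
    rw [h, LinearMap.det_comp]
    exact mul_pos ha hb
  inv_mem' := by
    intro a ha
    have h : (a.linearIsometryEquiv.toLinearEquiv : ℂ →ₗ[ℝ] ℂ) ∘ₗ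
        ((a⁻¹).linearIsometryEquiv.toLinearEquiv : ℂ →ₗ[ℝ] ℂ) = LinearMap.id := by
      apply LinearMap.ext
      intro x
      exact a.linearIsometryEquiv.apply_symm_apply x
    simp only [Set.mem_ofPred_eq] at ha ⊢
    have h2 := congrArg LinearMap.det h
    rw [LinearMap.det_comp, LinearMap.det_id] at h2
    by_contra hn
    have h3 := mul_nonpos_of_nonneg_of_nonpos ha.le (not_lt.mp hn)
    rw [h2] at h3
    linarith

/-- A rigid motion moves all three vertices. -/
def move (g : rigidMotions) (q : Config) : Config := fun i => (g : ℂ ≃ᵃⁱ[ℝ] ℂ) (q i)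

/-- The shape space distance between the oriented congruence classes of `q` and `q'`. -/
def shapeDist (m : Fin 3 → ℝ) (q q' : Config) : ℝ :=
  ⨅ g : rigidMotions × rigidMotions, massNorm m (move g.1 q - move g.2 q')

/-- First normalized Jacobi coordinate. -/
def jacobi₁ (m : Fin 3 → ℝ) (q : Config) : ℂ :=
  ((1 / Real.sqrt (1 / m 0 + 1 / m 1) : ℝ) : ℂ) * (q 0 - q 1)

/-- Second normalized Jacobi coordinate. -/
def jacobi₂ (m : Fin 3 → ℝ) (q : Config) : ℂ :=
  ((1 / Real.sqrt (1 / m 2 + 1 / (m 0 + m 1)) : ℝ) : ℂ) *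
    (q 2 - ((m 0 : ℂ) * q 0 + (m 1 : ℂ) * q 1) / ((m 0 : ℂ) + (m 1 : ℂ)))

/-- The projection `π : ℂ³ → ℝ³` onto shape space. -/
def shapeMap (m : Fin 3 → ℝ) (q : Config) : W :=
  !₂[(‖jacobi₁ m q‖ ^ 2 - ‖jacobi₂ m q‖ ^ 2) / 2,
    (jacobi₁ m q * conj (jacobi₂ m q)).re,
    (jacobi₁ m q * conj (jacobi₂ m q)).im]

/-- All three vertices coincide. -/
def IsTripleCollision (q : Config) : Prop := q 0 = q 1 ∧ q 1 = q 2

/-- The tangent space at `q` of the orbit `G q`: infinitesimal translations and rotations. -/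
def orbitTangent (q : Config) : Submodule ℝ Config :=
  Submodule.span ℝ {(fun _ => 1), (fun _ => Complex.I), (fun i => Complex.I * q i)}

/-- `t ↦ q + t v` is a line in `ℂ³` which is orthogonal, for the real part of the mass inner
product, to the `G`-orbit through each of its points. -/
def IsHorizontalLine (m : Fin 3 → ℝ) (q v : Config) : Prop :=
  v ≠ 0 ∧ ∀ t : ℝ, ∀ u ∈ orbitTangent (q + t • v), (massInner m u v).re = 0

/-- The Riemannian metric `|dw|² / (2 |w|)`, as a bilinear form at each `w ≠ 0`. -/
def shapeMetric (w u v : W) : ℝ := inner ℝ u v / (2 * ‖w‖)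

/-- `γ` restricts to a piecewise `C¹` path on `[a, b]` (in particular `a ≤ b`). -/
def IsPiecewiseC1 (γ : ℝ → W) (a b : ℝ) : Prop :=
  ∃ (n : ℕ) (p : ℕ → ℝ), Monotone p ∧ p 0 = a ∧ p n = b ∧
    ∀ i < n, ContDiffOn ℝ 1 γ (Icc (p i) (p (i + 1)))

/-- The length `∫ ds` of a path. Paths may pass through the singular point `0` of the metric; the
value of the integrand there is irrelevant, since the derivative of a piecewise `C¹` path vanishes
at almost every time at which the path is at `0`. -/
def pathLength (γ : ℝ → W) (a b : ℝ) : ℝ≥0∞ :=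
  ∫⁻ t in Icc a b, ENNReal.ofReal (Real.sqrt (shapeMetric (γ t) (deriv γ t) (deriv γ t)))

/-- The distance of the Riemannian metric: the infimum of the lengths of joining paths. -/
def metricDist (w w' : W) : ℝ≥0∞ :=
  sInf {L | ∃ (γ : ℝ → W) (a b : ℝ), IsPiecewiseC1 γ a b ∧ γ a = w ∧ γ b = w' ∧
    L = pathLength γ a b}

/-- `γ` is a (nonconstant) geodesic on the interval `J`: it is parametrized by a constant multiple
`c > 0` of arclength, and locally it realizes the distance between its points. -/
def IsGeodesicOn (γ : ℝ → W) (J : Set ℝ) : Prop :=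
  ∃ c : ℝ, 0 < c ∧ ∀ t ∈ J, ∃ ε > 0, ∀ s ∈ J, ∀ s' ∈ J,
    t - ε < s → s ≤ s' → s' < t + ε →
      IsPiecewiseC1 γ s s' ∧ pathLength γ s s' = ENNReal.ofReal (c * (s' - s)) ∧
        pathLength γ s s' = metricDist (γ s) (γ s')

/-- The plane `A w₁ + B w₂ + C w₃ = 0`. -/
def plane (A B C : ℝ) : Submodule ℝ W where
  carrier := {w | A * w 0 + B * w 1 + C * w 2 = 0}
  zero_mem' := by simp
  add_mem' := by
    intro x y hx hy
    simp only [Set.mem_ofPred_eq, PiLp.add_apply] at hx hy ⊢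
    linear_combination hx + hy
  smul_mem' := by
    intro r x hx
    simp only [Set.mem_ofPred_eq, PiLp.smul_apply, smul_eq_mul] at hx ⊢
    linear_combination r * hx

/-- Every geodesic which at some time is at a point of `S` other than the singular point `0`, with
velocity in `S`, stays in `S`. -/
def IsTotallyGeodesic (S : Submodule ℝ W) : Prop :=
  ∀ (J : Set ℝ) (γ : ℝ → W), J.OrdConnected → IsGeodesicOn γ J →
    ∀ t₀ ∈ J, γ t₀ ∈ S → γ t₀ ≠ 0 → derivWithin γ J t₀ ∈ S → ∀ t ∈ J, γ t ∈ S

/-- The point of the plane spanned by the orthonormal pair `e₁, e₂` with polar angle `p.2` and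
Euclidean norm `p.1 ^ 2 / 2`, that is `p.1 = √(2 |w|)`. -/
def polar (e₁ e₂ : W) (p : ℝ × ℝ) : W :=
  (p.1 ^ 2 / 2) • (Real.cos p.2 • e₁ + Real.sin p.2 • e₂)

end ShapeSpace

end

/-! In normalized Jacobi coordinates the mass form splits orthogonally into a centre-of-mass term
and the standard Hermitian form on `E = ℂ²` (`massInner_eq`). Translations move only the centre of
mass and rotations act on `E` by unit scalars, so shape space is the quotient of `E` by the circle,
and `π` is the Hopf map `hopf`.

The quotient distance is explicit. Minimizing `‖X - u • Y‖` over unit `u` gives `√(‖X‖² + ‖Y‖² -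
2|⟨X,Y⟩|)`, and `norm_inner_sq` writes `|⟨X,Y⟩|` in terms of the image points; this is `hopfDist`.
By `hopfDist_eq_norm_mul` its infinitesimal form is `|dw|/√(2|w|)`, so a path is at least as long as
the `hopfDist` of its ends. The projected segment between optimally aligned lifts attains this
bound, hence `metricDist_eq`.

A line in `E` is horizontal when `Im ⟨X,V⟩ = 0`. Nearby points on it are then optimally aligned, so
its projection is locally minimizing, except across the origin, where it folds back onto itself.
Conversely, nearest lifts to a lift of a middle point of a minimizing curve must lie on one line, by
strict convexity of the norm (`eq_of_optimal_lifts`). Projected lines are quadratic in time, so the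
local lines have the same projection (`hopf_line_unique`).

The three coefficients of such a quadratic lie in the span of position and velocity
(`norm_sq_smul_hopf`), so every linear subspace is totally geodesic. -/

noncomputable section

namespace ShapeSpace

open Filter Topology

/-! ### The Hopf map and its quotient distance. -/

/-- The Hermitian plane of pairs of Jacobi coordinates. -/
abbrev E : Type := EuclideanSpace ℂ (Fin 2)

/-- The Hopf map in Jacobi coordinates. -/
def hopf (X : E) : W :=
  !₂[(‖X 0‖ ^ 2 - ‖X 1‖ ^ 2) / 2, (X 0 * conj (X 1)).re, (X 0 * conj (X 1)).im]

/-- The derivative of the Hopf map at `X` in direction `V`. -/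
def hopfDeriv (X V : E) : W :=
  !₂[(X 0 * conj (V 0)).re - (X 1 * conj (V 1)).re,
    (X 0 * conj (V 1) + V 0 * conj (X 1)).re, (X 0 * conj (V 1) + V 0 * conj (X 1)).im]

/-- The quotient distance of the Hopf map, in terms of the image points. -/
def hopfDist (w w' : W) : ℝ :=
  √(2 * ‖w‖ + 2 * ‖w'‖ - 2 * √(2 * (‖w‖ * ‖w'‖ + inner ℝ w w')))

theorem norm_sq_complex (z : ℂ) : ‖z‖ ^ 2 = z.re ^ 2 + z.im ^ 2 := by
  rw [Complex.sq_norm, Complex.normSq_apply]; ring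

theorem norm_sq_E (X : E) :
    ‖X‖ ^ 2 = (X 0).re ^ 2 + (X 0).im ^ 2 + ((X 1).re ^ 2 + (X 1).im ^ 2) := by
  rw [EuclideanSpace.norm_sq_eq, Fin.sum_univ_two, norm_sq_complex, norm_sq_complex]

theorem norm_sq_W (w : W) : ‖w‖ ^ 2 = w 0 ^ 2 + w 1 ^ 2 + w 2 ^ 2 := by
  rw [EuclideanSpace.norm_sq_eq, Fin.sum_univ_three]; simp

theorem inner_W (w w' : W) : inner ℝ w w' = w 0 * w' 0 + w 1 * w' 1 + w 2 * w' 2 := by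
  rw [PiLp.inner_apply, Fin.sum_univ_three]; simp [mul_comm]

theorem inner_re_E (X Y : E) : (inner ℂ X Y).re =
    (X 0).re * (Y 0).re + (X 0).im * (Y 0).im + ((X 1).re * (Y 1).re + (X 1).im * (Y 1).im) := by
  rw [PiLp.inner_apply, Fin.sum_univ_two]; simp; ring

theorem inner_im_E (X Y : E) : (inner ℂ X Y).im =
    (X 0).re * (Y 0).im - (X 0).im * (Y 0).re + ((X 1).re * (Y 1).im - (X 1).im * (Y 1).re) := by
  rw [PiLp.inner_apply, Fin.sum_univ_two]; simp; ring

theorem hopf_zero (X : E) : hopf X 0 =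
    ((X 0).re ^ 2 + (X 0).im ^ 2 - ((X 1).re ^ 2 + (X 1).im ^ 2)) / 2 := by
  simp [hopf, norm_sq_complex]

theorem hopf_one (X : E) : hopf X 1 = (X 0).re * (X 1).re + (X 0).im * (X 1).im := by
  simp [hopf]

theorem hopf_two (X : E) : hopf X 2 = (X 0).im * (X 1).re - (X 0).re * (X 1).im := by
  simp [hopf]; ring

theorem hopfDeriv_zero (X V : E) : hopfDeriv X V 0 =
    (X 0).re * (V 0).re + (X 0).im * (V 0).im - ((X 1).re * (V 1).re + (X 1).im * (V 1).im) := by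
  simp [hopfDeriv]

theorem hopfDeriv_one (X V : E) : hopfDeriv X V 1 =
    (X 0).re * (V 1).re + (X 0).im * (V 1).im + ((V 0).re * (X 1).re + (V 0).im * (X 1).im) := by
  simp [hopfDeriv]

theorem hopfDeriv_two (X V : E) : hopfDeriv X V 2 =
    (X 0).im * (V 1).re - (X 0).re * (V 1).im + ((V 0).im * (X 1).re - (V 0).re * (X 1).im) := by
  simp [hopfDeriv]; ring

theorem norm_hopf (X : E) : ‖hopf X‖ = ‖X‖ ^ 2 / 2 := by
  rw [← sq_eq_sq₀ (norm_nonneg _) (by positivity), norm_sq_W, norm_sq_E, hopf_zero, hopf_one,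
    hopf_two]
  ring

theorem hopf_eq_zero_iff {X : E} : hopf X = 0 ↔ X = 0 := by
  rw [← norm_eq_zero, norm_hopf]; simp

theorem norm_inner_sq (X Y : E) : ‖inner ℂ X Y‖ ^ 2 =
    2 * (‖hopf X‖ * ‖hopf Y‖ + inner ℝ (hopf X) (hopf Y)) := by
  rw [norm_sq_complex, inner_re_E, inner_im_E, norm_hopf, norm_hopf, norm_sq_E, norm_sq_E, inner_W]
  simp only [hopf_zero, hopf_one, hopf_two]
  ring

theorem hopfDist_hopf (X Y : E) :
    hopfDist (hopf X) (hopf Y) = √(‖X‖ ^ 2 + ‖Y‖ ^ 2 - 2 * ‖inner ℂ X Y‖) := by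
  rw [hopfDist, ← norm_inner_sq, Real.sqrt_sq (norm_nonneg _), norm_hopf, norm_hopf]
  congr 1; ring

theorem norm_sub_sq_E (X Y : E) : ‖X - Y‖ ^ 2 = ‖X‖ ^ 2 + ‖Y‖ ^ 2 - 2 * (inner ℂ X Y).re := by
  rw [inner_re_E, norm_sq_E, norm_sq_E, norm_sq_E]; simp; ring

theorem hopf_smul {u : ℂ} (hu : ‖u‖ = 1) (X : E) : hopf (u • X) = hopf X := by
  have h : u.re ^ 2 + u.im ^ 2 = 1 := by rw [← norm_sq_complex, hu]; norm_num
  ext i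
  fin_cases i
  · simp only [Fin.zero_eta, hopf_zero]; simp
    linear_combination ((X 0).re ^ 2 + (X 0).im ^ 2 - ((X 1).re ^ 2 + (X 1).im ^ 2)) * h
  · simp only [Fin.mk_one, hopf_one]; simp
    linear_combination ((X 0).re * (X 1).re + (X 0).im * (X 1).im) * h
  · simp only [Fin.reduceFinMk, hopf_two]; simp
    linear_combination ((X 0).im * (X 1).re - (X 0).re * (X 1).im) * h

theorem hopfDist_le_norm_sub (X Y : E) : hopfDist (hopf X) (hopf Y) ≤ ‖X - Y‖ := by
  rw [hopfDist_hopf]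
  refine Real.sqrt_le_iff.2 ⟨norm_nonneg _, ?_⟩
  rw [norm_sub_sq_E]
  linarith [Complex.re_le_norm (inner ℂ X Y)]

theorem hopfDist_eq_norm_sub {X Y : E} (hre : 0 ≤ (inner ℂ X Y).re)
    (him : (inner ℂ X Y).im = 0) : hopfDist (hopf X) (hopf Y) = ‖X - Y‖ := by
  have h : ‖inner ℂ X Y‖ = (inner ℂ X Y).re := by
    rw [← sq_eq_sq₀ (norm_nonneg _) hre, norm_sq_complex, him]; ring
  rw [hopfDist_hopf, h, ← norm_sub_sq_E, Real.sqrt_sq (norm_nonneg _)]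

theorem inner_im_eq_zero_of_hopfDist_eq {X Y : E} (h : hopfDist (hopf X) (hopf Y) = ‖X - Y‖) :
    (inner ℂ X Y).im = 0 := by
  have h1 : hopfDist (hopf X) (hopf Y) ^ 2 = ‖X‖ ^ 2 + ‖Y‖ ^ 2 - 2 * ‖inner ℂ X Y‖ := by
    rw [hopfDist_hopf, Real.sq_sqrt]
    nlinarith [norm_inner_le_norm (𝕜 := ℂ) X Y, sq_nonneg (‖X‖ - ‖Y‖)]
  rw [h, norm_sub_sq_E] at h1
  have h2 : (inner ℂ X Y).re = ‖inner ℂ X Y‖ := by linarith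
  have h3 := norm_sq_complex (inner ℂ X Y)
  rw [← h2] at h3
  nlinarith

/-- The phase `u` rotates `⟨X,Y⟩` onto the nonnegative real axis; if the product vanishes, every
phase is optimal. -/
theorem exists_hopfDist_eq (X Y : E) :
    ∃ u : ℂ, ‖u‖ = 1 ∧ hopfDist (hopf X) (hopf Y) = ‖X - u • Y‖ := by
  by_cases h0 : inner ℂ X Y = 0
  · refine ⟨1, by simp, ?_⟩
    simpa using hopfDist_eq_norm_sub (X := X) (Y := Y) (by simp [h0]) (by simp [h0])
  · have hn : (‖inner ℂ X Y‖ : ℂ) ≠ 0 := by simpa using h0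
    have hu : ‖conj (inner ℂ X Y) / (‖inner ℂ X Y‖ : ℂ)‖ = 1 := by
      rw [norm_div, RCLike.norm_conj, Complex.norm_real, norm_norm]
      exact div_self (by simpa using h0)
    have hi : inner ℂ X ((conj (inner ℂ X Y) / (‖inner ℂ X Y‖ : ℂ)) • Y)
        = (‖inner ℂ X Y‖ : ℂ) := by
      rw [inner_smul_right, div_mul_eq_mul_div, Complex.conj_mul', sq, mul_div_assoc, div_self hn,
        mul_one]
    refine ⟨_, hu, ?_⟩
    rw [← hopf_smul hu Y]
    apply hopfDist_eq_norm_sub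
    · rw [hi, Complex.ofReal_re]; positivity
    · rw [hi, Complex.ofReal_im]

/-- Equal images have `hopfDist` zero, and an optimal phase turns this into a vanishing norm `‖X - u
• Y‖`. -/
theorem hopf_eq_hopf_iff {X Y : E} : hopf X = hopf Y ↔ ∃ u : ℂ, ‖u‖ = 1 ∧ X = u • Y := by
  constructor
  · intro h
    obtain ⟨u, hu, h1⟩ := exists_hopfDist_eq X Y
    refine ⟨u, hu, ?_⟩
    rw [← h, hopfDist_eq_norm_sub (X := X) (Y := X)] at h1
    · simpa [sub_eq_zero] using h1.symm
    · rw [inner_re_E]; linarith [mul_self_nonneg (X 0).re, mul_self_nonneg (X 0).im,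
        mul_self_nonneg (X 1).re, mul_self_nonneg (X 1).im]
    · rw [inner_im_E]; ring
  · rintro ⟨u, hu, rfl⟩
    exact hopf_smul hu Y

theorem surjective_hopf : Function.Surjective hopf := by
  intro w
  have hn := norm_sq_W w
  -- A lift with real first coordinate must have its square equal to `‖w‖ + w 0`; this degenerates
  -- only on the nonpositive first axis, where the first coordinate is taken to be zero.
  by_cases h : 0 < ‖w‖ + w 0
  · have hs : √(‖w‖ + w 0) ^ 2 = ‖w‖ + w 0 := Real.sq_sqrt h.le
    have hp : 0 < √(‖w‖ + w 0) := Real.sqrt_pos.2 h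
    refine ⟨!₂[(√(‖w‖ + w 0) : ℂ), (⟨w 1 / √(‖w‖ + w 0), -(w 2 / √(‖w‖ + w 0))⟩ : ℂ)], ?_⟩
    ext i
    fin_cases i
    · simp only [Fin.zero_eta, hopf_zero]; simp
      field_simp
      rw [hs]
      nlinarith
    · simp only [Fin.mk_one, hopf_one]; simp
      field_simp
    · simp only [Fin.reduceFinMk, hopf_two]; simp
      field_simp
  · have h0 : w 0 ≤ -‖w‖ := by linarith
    have h1 : w 1 = 0 := by nlinarith [norm_nonneg w, sq_nonneg (w 1), sq_nonneg (w 2)]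
    have h2 : w 2 = 0 := by nlinarith [norm_nonneg w, sq_nonneg (w 1), sq_nonneg (w 2)]
    have hs : √(-(2 * w 0)) ^ 2 = -(2 * w 0) := Real.sq_sqrt (by linarith [norm_nonneg w])
    refine ⟨!₂[(0 : ℂ), (√(-(2 * w 0)) : ℂ)], ?_⟩
    ext i
    fin_cases i
    · simp only [Fin.zero_eta, hopf_zero]; simp
      linarith
    · simp [hopf_one, h1]
    · simp [hopf_two, h2]

theorem exists_hopf_eq_and_hopfDist_eq (X : E) (w : W) :
    ∃ Y : E, hopf Y = w ∧ hopfDist (hopf X) w = ‖X - Y‖ := by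
  obtain ⟨Y, rfl⟩ := surjective_hopf w
  obtain ⟨u, hu, h⟩ := exists_hopfDist_eq X Y
  exact ⟨u • Y, hopf_smul hu Y, h⟩

theorem hopfDist_comm (w w' : W) : hopfDist w w' = hopfDist w' w := by
  rw [hopfDist, hopfDist, real_inner_comm, mul_comm ‖w‖, add_comm (2 * ‖w‖)]

theorem hopfDist_nonneg (w w' : W) : 0 ≤ hopfDist w w' := Real.sqrt_nonneg _

theorem hopfDist_zero_left (w : W) : hopfDist 0 w = √(2 * ‖w‖) := by
  simp [hopfDist]

/-- Lift the three points successively, each optimally aligned with the previous one; the norm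
inequality upstairs descends because projecting does not increase distance. -/
theorem hopfDist_triangle (w₁ w₂ w₃ : W) :
    hopfDist w₁ w₃ ≤ hopfDist w₁ w₂ + hopfDist w₂ w₃ := by
  obtain ⟨X, rfl⟩ := surjective_hopf w₁
  obtain ⟨Y, rfl, hY⟩ := exists_hopf_eq_and_hopfDist_eq X w₂
  obtain ⟨Z, rfl, hZ⟩ := exists_hopf_eq_and_hopfDist_eq Y w₃
  rw [hY, hZ]
  exact (hopfDist_le_norm_sub X Z).trans (norm_sub_le_norm_sub_add_norm_sub X Y Z)

/-- Obtained by rationalizing the difference under the root. As `w'` tends to `w ≠ 0` the factor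
tends to `1 / √(2‖w‖)`, the density of `ds`. -/
theorem hopfDist_eq_norm_mul (w w' : W) : hopfDist w w' =
    ‖w - w'‖ * √(2 / (‖w‖ + ‖w'‖ + √(2 * (‖w‖ * ‖w'‖ + inner ℝ w w')))) := by
  have hnn : 0 ≤ 2 * (‖w‖ * ‖w'‖ + inner ℝ w w') := by
    linarith [(abs_le.1 (abs_real_inner_le_norm w w')).1]
  have hs := Real.sq_sqrt hnn
  have hs0 := Real.sqrt_nonneg (2 * (‖w‖ * ‖w'‖ + inner ℝ w w'))
  set s := √(2 * (‖w‖ * ‖w'‖ + inner ℝ w w')) with hsdef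
  rw [hopfDist, ← hsdef]
  by_cases h : ‖w‖ + ‖w'‖ + s = 0
  · have h1 : ‖w‖ = 0 := by linarith [norm_nonneg w, norm_nonneg w']
    have h2 : ‖w'‖ = 0 := by linarith [norm_nonneg w, norm_nonneg w']
    have h3 : s = 0 := by linarith
    simp [h1, h2, h3]
  · have hp : 0 < ‖w‖ + ‖w'‖ + s :=
      lt_of_le_of_ne (by positivity) (Ne.symm h)
    rw [← Real.sqrt_sq (norm_nonneg (w - w')), ← Real.sqrt_mul (sq_nonneg _)]
    congr 1
    rw [norm_sub_sq_real]
    field_simp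
    linear_combination -hs

/-! ### The Hopf map along straight lines. -/

theorem hopf_add_smul (X V : E) (t : ℝ) :
    hopf (X + t • V) = hopf X + t • hopfDeriv X V + t ^ 2 • hopf V := by
  ext i
  fin_cases i
  · simp only [Fin.zero_eta, PiLp.add_apply, PiLp.smul_apply, hopf_zero, hopfDeriv_zero]; simp; ring
  · simp only [Fin.mk_one, PiLp.add_apply, PiLp.smul_apply, hopf_one, hopfDeriv_one]; simp; ring
  · simp only [Fin.reduceFinMk, PiLp.add_apply, PiLp.smul_apply, hopf_two, hopfDeriv_two]
    simp; ring

theorem hopfDeriv_add_smul (X V : E) (t : ℝ) :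
    hopfDeriv (X + t • V) V = hopfDeriv X V + (2 * t) • hopf V := by
  ext i
  fin_cases i
  · simp only [Fin.zero_eta, PiLp.add_apply, PiLp.smul_apply, hopf_zero, hopfDeriv_zero]; simp; ring
  · simp only [Fin.mk_one, PiLp.add_apply, PiLp.smul_apply, hopf_one, hopfDeriv_one]; simp; ring
  · simp only [Fin.reduceFinMk, PiLp.add_apply, PiLp.smul_apply, hopf_two, hopfDeriv_two]
    simp; ring

/-- The defect is exactly `(Im ⟨X,V⟩)²`, the contribution of the motion along the circle orbit. -/
theorem norm_hopfDeriv_le (X V : E) : ‖hopfDeriv X V‖ ≤ ‖X‖ * ‖V‖ := by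
  have h : ‖hopfDeriv X V‖ ^ 2 = (‖X‖ * ‖V‖) ^ 2 - (inner ℂ X V).im ^ 2 := by
    rw [mul_pow, norm_sq_W, norm_sq_E, norm_sq_E, inner_im_E, hopfDeriv_zero, hopfDeriv_one,
      hopfDeriv_two]
    ring
  rw [← sq_le_sq₀ (norm_nonneg _) (by positivity), h]
  linarith [sq_nonneg (inner ℂ X V).im]

/-- A horizontal line projects into the plane spanned by its initial point and velocity. -/
theorem norm_sq_smul_hopf {X V : E} (h : (inner ℂ X V).im = 0) :
    ‖X‖ ^ 2 • hopf V = (inner ℂ X V).re • hopfDeriv X V - ‖V‖ ^ 2 • hopf X := by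
  -- For `X ≠ 0`, write `V` as a real multiple of `X` plus a Hermitian-orthogonal vector `N`; then
  -- `hopf N` is a nonpositive multiple of `hopf X`. The coordinate identities encode this.
  rw [inner_im_E] at h
  rw [inner_re_E, norm_sq_E, norm_sq_E]
  ext i
  fin_cases i
  · simp only [Fin.zero_eta, PiLp.sub_apply, PiLp.smul_apply, hopf_zero, hopfDeriv_zero,
      smul_eq_mul]
    linear_combination ((X 0).re * (V 0).im - (X 0).im * (V 0).re -
      ((X 1).re * (V 1).im - (X 1).im * (V 1).re)) * h
  · simp only [Fin.mk_one, PiLp.sub_apply, PiLp.smul_apply, hopf_one, hopfDeriv_one, smul_eq_mul]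
    linear_combination ((X 0).re * (V 1).im - (X 0).im * (V 1).re -
      ((V 0).re * (X 1).im - (V 0).im * (X 1).re)) * h
  · simp only [Fin.reduceFinMk, PiLp.sub_apply, PiLp.smul_apply, hopf_two, hopfDeriv_two,
      smul_eq_mul]
    linear_combination ((X 0).re * (V 1).re + (X 0).im * (V 1).im -
      ((V 0).re * (X 1).re + (V 0).im * (X 1).im)) * h

theorem hasDerivAt_hopf_line (X V : E) (t : ℝ) :
    HasDerivAt (fun s : ℝ => hopf (X + s • V)) (hopfDeriv (X + t • V) V) t := by
  simp only [hopf_add_smul, hopfDeriv_add_smul]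
  have h := (((hasDerivAt_id t).smul_const (hopfDeriv X V)).const_add (hopf X)).add
    (((hasDerivAt_id t).pow 2).smul_const (hopf V))
  exact h.congr_deriv (by simp)

theorem contDiff_hopf_line (X V : E) : ContDiff ℝ 1 (fun s : ℝ => hopf (X + s • V)) := by
  simp only [hopf_add_smul]
  fun_prop

/-- Two projected lines which agree on a nontrivial interval agree everywhere. -/
theorem hopf_line_unique {X V X' V' : E} {a b : ℝ} (hab : a < b)
    (h : ∀ s ∈ Icc a b, hopf (X + s • V) = hopf (X' + s • V')) (s : ℝ) :
    hopf (X + s • V) = hopf (X' + s • V') := by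
  have ha := h a (by constructor <;> linarith)
  have hb := h b (by constructor <;> linarith)
  have hm := h ((a + b) / 2) (by constructor <;> linarith)
  simp only [hopf_add_smul] at ha hb hm ⊢
  ext i
  have ha := congrArg (fun w : W => w i) ha
  have hb := congrArg (fun w : W => w i) hb
  have hm := congrArg (fun w : W => w i) hm
  simp only [PiLp.add_apply, PiLp.smul_apply, smul_eq_mul] at ha hb hm ⊢
  have hne : (b - a) ^ 2 ≠ 0 := pow_ne_zero _ (by linarith)
  apply mul_left_cancel₀ hne
  -- Lagrange interpolation of a quadratic at `a`, `b` and their midpoint, with denominators cleared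
  -- by `(b - a) ^ 2`.
  linear_combination 2 * (s - b) * (s - (a + b) / 2) * ha + 2 * (s - a) * (s - (a + b) / 2) * hb
    - 4 * (s - a) * (s - b) * hm

/-! ### The Riemannian distance. -/

theorem sqrt_shapeMetric_self (w u : W) : √(shapeMetric w u u) = ‖u‖ / √(2 * ‖w‖) := by
  rw [shapeMetric, real_inner_self_eq_norm_sq, Real.sqrt_div (sq_nonneg _),
    Real.sqrt_sq (norm_nonneg _)]

theorem hopfDist_self (w : W) : hopfDist w w = 0 := by
  rw [hopfDist_eq_norm_mul, sub_self, norm_zero, zero_mul]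

theorem tendsto_hopfDist {α : Type*} {l : Filter α} {f g : α → W} {x y : W}
    (hf : Tendsto f l (𝓝 x)) (hg : Tendsto g l (𝓝 y)) :
    Tendsto (fun t => hopfDist (f t) (g t)) l (𝓝 (hopfDist x y)) :=
  (((hf.norm.const_mul 2).add (hg.norm.const_mul 2)).sub
    ((((hf.norm.mul hg.norm).add (hf.inner hg)).const_mul 2).sqrt.const_mul 2)).sqrt

theorem continuousOn_hopfDist {f g : ℝ → W} {s : Set ℝ} (hf : ContinuousOn f s)
    (hg : ContinuousOn g s) : ContinuousOn (fun t => hopfDist (f t) (g t)) s :=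
  fun x hx => tendsto_hopfDist (hf x hx) (hg x hx)

theorem hasDerivAt_integral_of_continuous {σ : ℝ → ℝ} (hσ : Continuous σ) (a x : ℝ) :
    HasDerivAt (fun t => ∫ s in a..t, σ s) (σ x) x :=
  (hσ.integral_hasStrictDerivAt a x).hasDerivAt

theorem pathLength_mono (γ : ℝ → W) {a b a' b' : ℝ} (ha : a' ≤ a) (hb : b ≤ b') :
    pathLength γ a b ≤ pathLength γ a' b' :=
  lintegral_mono_set (Icc_subset_Icc ha hb)

theorem pathLength_add (γ : ℝ → W) {a b c : ℝ} (hab : a ≤ b) (hbc : b ≤ c) :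
    pathLength γ a b + pathLength γ b c = pathLength γ a c := by
  unfold pathLength
  rw [setLIntegral_congr (μ := volume) (Ioc_ae_eq_Icc (a := b) (b := c)).symm,
    ← Icc_union_Ioc_eq_Icc hab hbc, lintegral_union measurableSet_Ioc]
  exact Set.disjoint_left.2 fun x hx hx' => not_lt.2 hx.2 hx'.1

/-- A `C¹` path that avoids the singular point is at least as long as the distance between
its endpoints. -/
theorem hopfDist_le_pathLength_of_ne_zero {γ : ℝ → W} {a b : ℝ} (hab : a < b)
    (hγ : ContDiffOn ℝ 1 γ (Icc a b)) (h0 : ∀ t ∈ Icc a b, γ t ≠ 0) :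
    ENNReal.ofReal (hopfDist (γ a) (γ b)) ≤ pathLength γ a b := by
  have hu := uniqueDiffOn_Icc hab
  have hcd := hγ.continuousOn_derivWithin hu le_rfl
  set σ₀ : ℝ → ℝ := fun t => ‖derivWithin γ (Icc a b) t‖ / √(2 * ‖γ t‖) with hσ₀
  have hσ₀c : ContinuousOn σ₀ (Icc a b) := by
    refine hcd.norm.div ((continuousOn_const.mul hγ.continuousOn.norm).sqrt) fun t ht => ?_
    have := norm_pos_iff.2 (h0 t ht)
    positivity
  -- The speed is extended constantly beyond the endpoints, so that its primitive is differentiable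
  -- everywhere.
  obtain ⟨σ, hσc, hσn, hσe⟩ :
      ∃ σ : ℝ → ℝ, Continuous σ ∧ (∀ t, 0 ≤ σ t) ∧ ∀ t ∈ Icc a b, σ t = σ₀ t := by
    refine ⟨IccExtend hab.le ((Icc a b).domRestrict σ₀),
      (continuousOn_iff_continuous_domRestrict.1 hσ₀c).Icc_extend', fun t => ?_, fun t ht => ?_⟩
    · exact div_nonneg (norm_nonneg _) (Real.sqrt_nonneg _)
    · rw [IccExtend_of_mem _ _ ht]; rfl
  have hmain : hopfDist (γ a) (γ b) ≤ ∫ s in a..b, σ s := by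
    have hB : ∀ x, HasDerivAt (fun t => ∫ s in a..t, σ s) (σ x) x :=
      hasDerivAt_integral_of_continuous hσc a
    have hFa : hopfDist (γ a) (γ a) ≤ ∫ s in a..a, σ s := by
      rw [hopfDist_self, intervalIntegral.integral_same]
    have hFc : ContinuousOn (fun t => hopfDist (γ a) (γ t)) (Icc a b) :=
      continuousOn_hopfDist continuousOn_const hγ.continuousOn
    -- Only an upper bound on right slopes is needed, so `hopfDist (γ a)` need not be differentiable
    -- along `γ`: the triangle inequality reduces its increments to `hopfDist (γ x) (γ z)`.
    have key := image_le_of_liminf_slope_right_le_deriv_boundary hFc hFa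
      (fun x _ => (hB x).continuousAt.continuousWithinAt) (fun x _ => (hB x).hasDerivWithinAt) ?_
    · exact key (right_mem_Icc.2 hab.le)
    · intro x hx r hr
      have hxI : x ∈ Icc a b := Ico_subset_Icc_self hx
      have hd : HasDerivWithinAt γ (derivWithin γ (Icc a b) x) (Ioi x) x :=
        ((hγ.differentiableOn one_ne_zero x hxI).hasDerivWithinAt).mono_of_mem_nhdsWithin
          (mem_of_superset (Ioc_mem_nhdsGT hx.2) fun y hy => ⟨hx.1.trans hy.1.le, hy.2⟩)
      have hsl := (hasDerivWithinAt_iff_tendsto_slope' self_notMem_Ioi).1 hd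
      have hcont : Tendsto γ (𝓝[>] x) (𝓝 (γ x)) := hd.continuousWithinAt
      have hx0 := norm_pos_iff.2 (h0 x hxI)
      have hK : Tendsto (fun z =>
          √(2 / (‖γ x‖ + ‖γ z‖ + √(2 * (‖γ x‖ * ‖γ z‖ + inner ℝ (γ x) (γ z))))))
          (𝓝[>] x) (𝓝 √(2 / (‖γ x‖ + ‖γ x‖ + √(2 * (‖γ x‖ * ‖γ x‖ + inner ℝ (γ x) (γ x)))))) := by
        refine (Tendsto.div tendsto_const_nhds ?_ (by positivity)).sqrt
        exact (tendsto_const_nhds.add hcont.norm).add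
          ((tendsto_const_nhds.mul ((tendsto_const_nhds.mul hcont.norm).add
            (tendsto_const_nhds.inner hcont))).sqrt)
      have hlim := hsl.norm.mul hK
      have hval : ‖derivWithin γ (Icc a b) x‖ *
          √(2 / (‖γ x‖ + ‖γ x‖ + √(2 * (‖γ x‖ * ‖γ x‖ + inner ℝ (γ x) (γ x))))) = σ x := by
        rw [hσe x hxI]
        simp only [hσ₀]
        rw [div_eq_mul_inv ‖_‖, ← Real.sqrt_inv, real_inner_self_eq_norm_sq,
          show 2 * (‖γ x‖ * ‖γ x‖ + ‖γ x‖ ^ 2) = (2 * ‖γ x‖) ^ 2 by ring,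
          Real.sqrt_sq (by positivity)]
        congr 2
        field_simp
        ring
      rw [hval] at hlim
      refine Eventually.frequently ?_
      filter_upwards [hlim.eventually_lt_const hr, self_mem_nhdsWithin] with z hz hxz
      refine lt_of_le_of_lt ?_ hz
      have hxz' : 0 < z - x := sub_pos.2 hxz
      rw [slope_def_field, slope_def_module, norm_smul, norm_inv, Real.norm_of_nonneg hxz'.le,
        div_le_iff₀ hxz']
      have htri := hopfDist_triangle (γ a) (γ x) (γ z)
      rw [hopfDist_eq_norm_mul (γ x) (γ z), norm_sub_rev] at htri
      field_simp
      linarith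
  have hpl : pathLength γ a b = ENNReal.ofReal (∫ s in a..b, σ s) := by
    rw [intervalIntegral.integral_of_le hab.le, ofReal_integral_eq_lintegral_ofReal
      ((hσc.integrableOn_Icc (a := a) (b := b)).mono_set Ioc_subset_Icc_self)
      (ae_of_all _ hσn), setLIntegral_congr (μ := volume) (Ioo_ae_eq_Ioc (a := a) (b := b)).symm,
      pathLength, setLIntegral_congr (μ := volume) (Ioo_ae_eq_Icc (a := a) (b := b)).symm]
    -- On the open interval `deriv` and `derivWithin` agree; at the endpoints they may not, which is
    -- a null set.
    refine setLIntegral_congr_fun measurableSet_Ioo fun t ht => ?_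
    have htI := Ioo_subset_Icc_self ht
    simp only [sqrt_shapeMetric_self]
    rw [hσe t htI]
    simp only [hσ₀]
    rw [derivWithin_of_mem_nhds (Icc_mem_nhds ht.1 ht.2)]
  rw [hpl]
  exact ENNReal.ofReal_le_ofReal hmain

/-- The endpoints may be singular: apply the regular case to inner subintervals and pass to the
limit, since `hopfDist` is continuous at the origin too. -/
theorem hopfDist_le_pathLength_of_ne_zero_Ioo {γ : ℝ → W} {a b : ℝ} (hab : a ≤ b)
    (hγ : ContDiffOn ℝ 1 γ (Icc a b)) (h0 : ∀ t ∈ Ioo a b, γ t ≠ 0) :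
    ENNReal.ofReal (hopfDist (γ a) (γ b)) ≤ pathLength γ a b := by
  rcases hab.eq_or_lt with rfl | hab
  · rw [hopfDist_self]; simp
  have hin : ∀ u v, a < u → u < v → v < b →
      ENNReal.ofReal (hopfDist (γ u) (γ v)) ≤ pathLength γ a b := fun u v hu huv hv =>
    (hopfDist_le_pathLength_of_ne_zero huv (hγ.mono (Icc_subset_Icc hu.le hv.le)) fun t ht =>
      h0 t ⟨hu.trans_le ht.1, ht.2.trans_lt hv⟩).trans (pathLength_mono γ hu.le hv.le)
  have hcb : Tendsto γ (𝓝[<] b) (𝓝 (γ b)) :=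
    (hγ.continuousOn b (right_mem_Icc.2 hab.le)).mono_of_mem_nhdsWithin
      (mem_of_superset (Ico_mem_nhdsLT hab) Ico_subset_Icc_self)
  have hca : Tendsto γ (𝓝[>] a) (𝓝 (γ a)) :=
    (hγ.continuousOn a (left_mem_Icc.2 hab.le)).mono_of_mem_nhdsWithin
      (mem_of_superset (Ioc_mem_nhdsGT hab) Ioc_subset_Icc_self)
  have hin' : ∀ u, a < u → u < b →
      ENNReal.ofReal (hopfDist (γ u) (γ b)) ≤ pathLength γ a b := fun u hu hub => by
    refine le_of_tendsto (ENNReal.tendsto_ofReal (tendsto_hopfDist tendsto_const_nhds hcb)) ?_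
    filter_upwards [Ioo_mem_nhdsLT hub] with v hv
    exact hin u v hu hv.1 hv.2
  refine le_of_tendsto (ENNReal.tendsto_ofReal (tendsto_hopfDist hca tendsto_const_nhds)) ?_
  filter_upwards [Ioo_mem_nhdsGT hab] with u hu
  exact hin' u hu.1 hu.2

theorem ofReal_hopfDist_triangle (w₁ w₂ w₃ : W) : ENNReal.ofReal (hopfDist w₁ w₃) ≤
    ENNReal.ofReal (hopfDist w₁ w₂) + ENNReal.ofReal (hopfDist w₂ w₃) := by
  rw [← ENNReal.ofReal_add (hopfDist_nonneg _ _) (hopfDist_nonneg _ _)]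
  exact ENNReal.ofReal_le_ofReal (hopfDist_triangle _ _ _)

/-- The zeros of `γ` can form any compact set, but only the first and the last matter: what lies
between them starts and ends at the origin and can be discarded. -/
theorem hopfDist_le_pathLength_of_contDiffOn {γ : ℝ → W} {a b : ℝ} (hab : a ≤ b)
    (hγ : ContDiffOn ℝ 1 γ (Icc a b)) :
    ENNReal.ofReal (hopfDist (γ a) (γ b)) ≤ pathLength γ a b := by
  set S : Set ℝ := Icc a b ∩ γ ⁻¹' {0} with hS
  have hSc : IsCompact S := isCompact_Icc.of_isClosed_subset
    (hγ.continuousOn.preimage_isClosed_of_isClosed isClosed_Icc isClosed_singleton)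
    inter_subset_left
  rcases S.eq_empty_or_nonempty with hSe | hSn
  · refine hopfDist_le_pathLength_of_ne_zero_Ioo hab hγ fun t ht h => ?_
    have : t ∈ S := ⟨Ioo_subset_Icc_self ht, h⟩
    simp [hSe] at this
  obtain ⟨z₁, hz₁, h₁⟩ := hSc.exists_isLeast hSn
  obtain ⟨z₂, hz₂, h₂⟩ := hSc.exists_isGreatest hSn
  have e₁ : γ z₁ = 0 := hz₁.2
  have e₂ : γ z₂ = 0 := hz₂.2
  have hl₁ := hopfDist_le_pathLength_of_ne_zero_Ioo hz₁.1.1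
    (hγ.mono (Icc_subset_Icc le_rfl hz₁.1.2)) fun t ht h =>
      not_lt.2 (h₁ ⟨⟨ht.1.le, ht.2.le.trans hz₁.1.2⟩, h⟩) ht.2
  have hl₂ := hopfDist_le_pathLength_of_ne_zero_Ioo hz₂.1.2
    (hγ.mono (Icc_subset_Icc hz₂.1.1 le_rfl)) fun t ht h =>
      not_lt.2 (h₂ ⟨⟨hz₂.1.1.trans ht.1.le, ht.2.le⟩, h⟩) ht.1
  rw [e₁] at hl₁
  rw [e₂] at hl₂
  calc _ ≤ _ := ofReal_hopfDist_triangle (γ a) 0 (γ b)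
    _ ≤ pathLength γ a z₁ + pathLength γ z₂ b := add_le_add hl₁ hl₂
    _ ≤ pathLength γ a z₁ + pathLength γ z₁ b := by
        gcongr; exact pathLength_mono γ (h₁ hz₂) le_rfl
    _ = _ := pathLength_add γ hz₁.1.1 hz₁.1.2

theorem hopfDist_le_pathLength {γ : ℝ → W} {a b : ℝ} (hγ : IsPiecewiseC1 γ a b) :
    ENNReal.ofReal (hopfDist (γ a) (γ b)) ≤ pathLength γ a b := by
  obtain ⟨n, p, hp, rfl, rfl, hC⟩ := hγ
  have : ∀ k ≤ n, ENNReal.ofReal (hopfDist (γ (p 0)) (γ (p k))) ≤ pathLength γ (p 0) (p k) := by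
    intro k
    induction k with
    | zero => intro _; rw [hopfDist_self]; simp
    | succ k ih =>
      intro hk
      calc _ ≤ _ := ofReal_hopfDist_triangle (γ (p 0)) (γ (p k)) (γ (p (k + 1)))
        _ ≤ pathLength γ (p 0) (p k) + pathLength γ (p k) (p (k + 1)) :=
          add_le_add (ih (by omega))
            (hopfDist_le_pathLength_of_contDiffOn (hp (Nat.le_succ k)) (hC k (by omega)))
        _ = _ := pathLength_add γ (hp (Nat.zero_le k)) (hp (Nat.le_succ k))
  exact this n le_rfl

theorem ofReal_hopfDist_le_metricDist (w w' : W) :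
    ENNReal.ofReal (hopfDist w w') ≤ metricDist w w' := by
  refine le_sInf ?_
  rintro L ⟨γ, a, b, hγ, rfl, rfl, rfl⟩
  exact hopfDist_le_pathLength hγ

theorem isPiecewiseC1_of_contDiffOn {γ : ℝ → W} {a b : ℝ} (hab : a ≤ b)
    (hγ : ContDiffOn ℝ 1 γ (Icc a b)) : IsPiecewiseC1 γ a b := by
  refine ⟨1, fun i => if i = 0 then a else b, ?_, by simp, by simp, ?_⟩
  · intro i j hij
    by_cases hi : i = 0
    · by_cases hj : j = 0 <;> simp [hi, hj, hab]
    · have hj : j ≠ 0 := by omega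
      simp [hi, hj]
  · intro i hi
    obtain rfl : i = 0 := by omega
    simpa using hγ

/-- The projection of a segment is at most as long as the segment. -/
theorem pathLength_le_of_eq_hopf_line {γ : ℝ → W} {X V : E} {a b : ℝ}
    (hγ : ∀ t ∈ Icc a b, γ t = hopf (X + t • V)) :
    pathLength γ a b ≤ ENNReal.ofReal (‖V‖ * (b - a)) := by
  rw [pathLength, setLIntegral_congr (μ := volume) (Ioo_ae_eq_Icc (a := a) (b := b)).symm]
  calc _ ≤ ∫⁻ _ in Ioo a b, ENNReal.ofReal ‖V‖ := by
        refine setLIntegral_mono measurable_const fun t ht => ENNReal.ofReal_le_ofReal ?_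
        have hev : γ =ᶠ[𝓝 t] fun s => hopf (X + s • V) := by
          filter_upwards [Icc_mem_nhds ht.1 ht.2] with s hs using hγ s hs
        rw [sqrt_shapeMetric_self, hev.eq_of_nhds, hev.deriv_eq,
          (hasDerivAt_hopf_line X V t).deriv, norm_hopf, mul_div_cancel₀ _ two_ne_zero,
          Real.sqrt_sq (norm_nonneg _)]
        refine div_le_of_le_mul₀ (norm_nonneg _) (norm_nonneg _) ?_
        rw [mul_comm]
        exact norm_hopfDeriv_le _ _
    _ = _ := by
      rw [setLIntegral_const, Real.volume_Ioo, ENNReal.ofReal_mul (norm_nonneg _)]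

/-- The upper bound comes from projecting the segment between optimally aligned lifts. -/
theorem metricDist_eq (w w' : W) : metricDist w w' = ENNReal.ofReal (hopfDist w w') := by
  refine le_antisymm ?_ (ofReal_hopfDist_le_metricDist w w')
  obtain ⟨X, rfl⟩ := surjective_hopf w
  obtain ⟨Y, rfl, hY⟩ := exists_hopf_eq_and_hopfDist_eq X w'
  have hlen := pathLength_le_of_eq_hopf_line (γ := fun t : ℝ => hopf (X + t • (Y - X)))
    (X := X) (V := Y - X) (a := 0) (b := 1) fun t _ => rfl
  rw [sub_zero, mul_one, norm_sub_rev, ← hY] at hlen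
  refine (sInf_le ?_).trans hlen
  exact ⟨_, 0, 1, isPiecewiseC1_of_contDiffOn zero_le_one (contDiff_hopf_line X (Y - X)).contDiffOn,
    by simp, by simp, rfl⟩

/-! ### Rigid motions and Jacobi coordinates. -/

theorem exists_rigidMotion_eq (g : rigidMotions) :
    ∃ u b : ℂ, ‖u‖ = 1 ∧ ∀ z, (g : ℂ ≃ᵃⁱ[ℝ] ℂ) z = u * z + b := by
  obtain ⟨g, hg⟩ := g
  have hg' : 0 < LinearMap.det (g.linearIsometryEquiv.toLinearEquiv : ℂ →ₗ[ℝ] ℂ) := hg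
  have hz : ∀ z, g z = g.linearIsometryEquiv z + g 0 := fun z => by
    simpa using g.map_vadd 0 z
  obtain ⟨a, ha | ha⟩ := linear_isometry_complex g.linearIsometryEquiv
  · refine ⟨a, g 0, Circle.norm_coe a, fun z => ?_⟩
    rw [hz z, ha, rotation_apply]
  -- A linear part involving conjugation has determinant `-1`.
  · exfalso
    have hc : ((Complex.conjLIE.trans (rotation a)).toLinearEquiv : ℂ →ₗ[ℝ] ℂ) =
        ((rotation a).toLinearEquiv : ℂ →ₗ[ℝ] ℂ) ∘ₗ
          (Complex.conjLIE.toLinearEquiv : ℂ →ₗ[ℝ] ℂ) := rfl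
    rw [ha, hc, LinearMap.det_comp, det_rotation, Complex.det_conjLIE] at hg'
    norm_num at hg'

theorem exists_rigidMotion {u : ℂ} (hu : ‖u‖ = 1) (b : ℂ) :
    ∃ g : rigidMotions, ∀ z, (g : ℂ ≃ᵃⁱ[ℝ] ℂ) z = u * z + b := by
  let a : Circle := ⟨u, mem_sphere_zero_iff_norm.2 hu⟩
  refine ⟨⟨(rotation a).toAffineIsometryEquiv.trans (AffineIsometryEquiv.constVAdd ℝ ℂ b), ?_⟩, ?_⟩
  · change 0 < LinearMap.det ((rotation a).toLinearEquiv : ℂ →ₗ[ℝ] ℂ)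
    rw [det_rotation]
    exact one_pos
  · intro z
    change b + a * z = u * z + b
    rw [add_comm]

/-- The pair of normalized Jacobi coordinates. -/
def jacobi (m : Fin 3 → ℝ) : Config →ₗ[ℂ] E where
  toFun q := !₂[jacobi₁ m q, jacobi₂ m q]
  map_add' q q' := by
    ext i
    fin_cases i
    · simp [jacobi₁]; ring
    · simp [jacobi₂]; ring
  map_smul' c q := by
    ext i
    fin_cases i
    · simp [jacobi₁]; ring
    · simp [jacobi₂]; ring

/-- The center of mass. -/
def massCenter (m : Fin 3 → ℝ) : Config →ₗ[ℂ] ℂ where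
  toFun q := (m 0 * q 0 + m 1 * q 1 + m 2 * q 2) / (m 0 + m 1 + m 2)
  map_add' q q' := by simp; ring
  map_smul' c q := by simp; ring

variable {m : Fin 3 → ℝ}

theorem shapeMap_eq (m : Fin 3 → ℝ) (q : Config) : shapeMap m q = hopf (jacobi m q) := rfl

theorem jacobi_add_smul (q v : Config) (t : ℝ) :
    jacobi m (q + t • v) = jacobi m q + t • jacobi m v := by
  rw [map_add, LinearMap.map_smul_of_tower]

theorem jacobi_affine (u b : ℂ) (hm : ∀ i, 0 < m i) (q : Config) :
    jacobi m (fun i => u * q i + b) = u • jacobi m q := by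
  have h : (m 0 : ℂ) + m 1 ≠ 0 := by exact_mod_cast (add_pos (hm 0) (hm 1)).ne'
  ext i
  fin_cases i
  · simp [jacobi, jacobi₁]; ring
  · simp [jacobi, jacobi₂]
    field_simp
    ring

theorem massCenter_affine (u b : ℂ) (hm : ∀ i, 0 < m i) (q : Config) :
    massCenter m (fun i => u * q i + b) = u * massCenter m q + b := by
  have h : (m 0 : ℂ) + m 1 + m 2 ≠ 0 := by
    exact_mod_cast (add_pos (add_pos (hm 0) (hm 1)) (hm 2)).ne'
  simp [massCenter]
  field_simp
  ring

/-- The squared normalizing constants are the reduced masses, precisely what makes the mass form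
diagonal in these coordinates. -/
theorem massInner_eq (hm : ∀ i, 0 < m i) (v w : Config) : massInner m v w =
    (m 0 + m 1 + m 2) * (conj (massCenter m v) * massCenter m w) +
      inner ℂ (jacobi m v) (jacobi m w) := by
  have h0 := hm 0
  have h1 := hm 1
  have h2 := hm 2
  have hc₁ : ((1 / √(1 / m 0 + 1 / m 1) : ℝ) : ℂ) ^ 2 = m 0 * m 1 / (m 0 + m 1) := by
    have : (1 / √(1 / m 0 + 1 / m 1)) ^ 2 = m 0 * m 1 / (m 0 + m 1) := by
      rw [div_pow, Real.sq_sqrt (by positivity)]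
      field_simp
      ring
    exact_mod_cast congrArg (fun x : ℝ => (x : ℂ)) this
  have hc₂ : ((1 / √(1 / m 2 + 1 / (m 0 + m 1)) : ℝ) : ℂ) ^ 2 =
      m 2 * (m 0 + m 1) / (m 0 + m 1 + m 2) := by
    have : (1 / √(1 / m 2 + 1 / (m 0 + m 1))) ^ 2 =
        m 2 * (m 0 + m 1) / (m 0 + m 1 + m 2) := by
      rw [div_pow, Real.sq_sqrt (by positivity)]
      field_simp
    exact_mod_cast congrArg (fun x : ℝ => (x : ℂ)) this
  have h01 : (m 0 : ℂ) + m 1 ≠ 0 := by exact_mod_cast (add_pos h0 h1).ne'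
  have h012 : (m 0 : ℂ) + m 1 + m 2 ≠ 0 := by exact_mod_cast (add_pos (add_pos h0 h1) h2).ne'
  rw [PiLp.inner_apply, Fin.sum_univ_two, massInner, Fin.sum_univ_three]
  simp only [jacobi, LinearMap.coe_mk, AddHom.coe_mk, jacobi₁, jacobi₂, massCenter,
    RCLike.inner_apply, PiLp.toLp_apply, Matrix.cons_val_zero, Matrix.cons_val_one,
    map_mul, map_add, map_sub, map_div₀, Complex.conj_ofReal]
  generalize ((1 / √(1 / m 0 + 1 / m 1) : ℝ) : ℂ) = c₁ at *
  generalize ((1 / √(1 / m 2 + 1 / (m 0 + m 1)) : ℝ) : ℂ) = c₂ at *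
  have e₁ : ∀ x y : ℂ, c₁ * x * (c₁ * y) = m 0 * m 1 / (m 0 + m 1) * (x * y) := fun x y => by
    rw [← hc₁]; ring
  have e₂ : ∀ x y : ℂ, c₂ * x * (c₂ * y) = m 2 * (m 0 + m 1) / (m 0 + m 1 + m 2) * (x * y) :=
    fun x y => by rw [← hc₂]; ring
  rw [e₁, e₂]
  field_simp
  ring

theorem massNorm_eq (hm : ∀ i, 0 < m i) (v : Config) : massNorm m v =
    √((m 0 + m 1 + m 2) * ‖massCenter m v‖ ^ 2 + ‖jacobi m v‖ ^ 2) := by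
  rw [massNorm, massInner_eq hm, Complex.conj_mul', Complex.add_re]
  congr 2
  · norm_cast
  · rw [inner_re_E, norm_sq_E]; ring

theorem eq_zero_of_jacobi_of_massCenter (hm : ∀ i, 0 < m i) {v : Config}
    (h : jacobi m v = 0) (h' : massCenter m v = 0) : v = 0 := by
  have h1 := massInner_eq hm v v
  rw [h, h', massInner, Fin.sum_univ_three] at h1
  have h2 := congrArg Complex.re h1
  simp only [mul_assoc, Complex.conj_mul'] at h2
  norm_cast at h2
  simp at h2
  norm_cast at h2
  have h0 := mul_nonneg (hm 0).le (sq_nonneg ‖v 0‖)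
  have h1 := mul_nonneg (hm 1).le (sq_nonneg ‖v 1‖)
  have h3 := mul_nonneg (hm 2).le (sq_nonneg ‖v 2‖)
  have key : ∀ i, m i * ‖v i‖ ^ 2 = 0 → v i = 0 := fun i hi => by
    simpa [(hm i).ne'] using hi
  funext i
  fin_cases i
  · exact key 0 (by linarith)
  · exact key 1 (by linarith)
  · exact key 2 (by linarith)

theorem exists_jacobi_eq (hm : ∀ i, 0 < m i) (X : E) :
    ∃ q : Config, jacobi m q = X ∧ massCenter m q = 0 := by
  have h0 := hm 0
  have h1 := hm 1
  have h2 := hm 2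
  have h01 : (m 0 : ℂ) + m 1 ≠ 0 := by exact_mod_cast (add_pos h0 h1).ne'
  have hc₁ : ((1 / √(1 / m 0 + 1 / m 1) : ℝ) : ℂ) ≠ 0 :=
    Complex.ofReal_ne_zero.2 (by positivity)
  have hc₂ : ((1 / √(1 / m 2 + 1 / (m 0 + m 1)) : ℝ) : ℂ) ≠ 0 :=
    Complex.ofReal_ne_zero.2 (by positivity)
  have hq : ∃ q : Config, jacobi m q = X := by
    refine ⟨![X 0 / ((1 / √(1 / m 0 + 1 / m 1) : ℝ) : ℂ), 0,
      X 1 / ((1 / √(1 / m 2 + 1 / (m 0 + m 1)) : ℝ) : ℂ) +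
        m 0 * (X 0 / ((1 / √(1 / m 0 + 1 / m 1) : ℝ) : ℂ)) / (m 0 + m 1)], ?_⟩
    simp only [jacobi, LinearMap.coe_mk, AddHom.coe_mk, jacobi₁, jacobi₂]
    generalize ((1 / √(1 / m 0 + 1 / m 1) : ℝ) : ℂ) = c₁ at *
    generalize ((1 / √(1 / m 2 + 1 / (m 0 + m 1)) : ℝ) : ℂ) = c₂ at *
    ext i
    fin_cases i
    · simp
      field_simp
    · simp
      field_simp
  obtain ⟨q, hq⟩ := hq
  -- Translating moves the centre of mass to `0` without changing the Jacobi coordinates.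
  refine ⟨fun i => 1 * q i + -massCenter m q, ?_, ?_⟩
  · rw [jacobi_affine _ _ hm, hq, one_smul]
  · rw [massCenter_affine _ _ hm]; ring

theorem surjective_shapeMap (hm : ∀ i, 0 < m i) : Function.Surjective (shapeMap m) := by
  intro w
  obtain ⟨X, rfl⟩ := surjective_hopf w
  obtain ⟨q, rfl, -⟩ := exists_jacobi_eq hm X
  exact ⟨q, rfl⟩

theorem shapeMap_eq_shapeMap_iff (hm : ∀ i, 0 < m i) (q q' : Config) :
    shapeMap m q = shapeMap m q' ↔ ∃ g : rigidMotions, move g q = q' := by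
  rw [shapeMap_eq, shapeMap_eq]
  constructor
  · intro h
    obtain ⟨u, hu, h⟩ := hopf_eq_hopf_iff.1 h.symm
    obtain ⟨g, hg⟩ := exists_rigidMotion hu (massCenter m q' - u * massCenter m q)
    have hmv : move g q = fun i => u * q i + (massCenter m q' - u * massCenter m q) :=
      funext fun i => hg (q i)
    refine ⟨g, sub_eq_zero.1 (eq_zero_of_jacobi_of_massCenter hm ?_ ?_)⟩
    · rw [map_sub, hmv, jacobi_affine _ _ hm, h, sub_self]
    · rw [map_sub, hmv, massCenter_affine _ _ hm]; ring
  · rintro ⟨g, rfl⟩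
    obtain ⟨u, b, hu, hg⟩ := exists_rigidMotion_eq g
    have hmv : move g q = fun i => u * q i + b := funext fun i => hg (q i)
    rw [hmv, jacobi_affine _ _ hm, hopf_smul hu]

/-- The centre-of-mass term of the norm is nonnegative and can be made zero by a translation,
leaving the minimization over phases. -/
theorem shapeDist_eq (hm : ∀ i, 0 < m i) (q q' : Config) :
    shapeDist m q q' = hopfDist (shapeMap m q) (shapeMap m q') := by
  have hM : 0 < m 0 + m 1 + m 2 := add_pos (add_pos (hm 0) (hm 1)) (hm 2)
  have hle : ∀ g : rigidMotions × rigidMotions,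
      hopfDist (shapeMap m q) (shapeMap m q') ≤ massNorm m (move g.1 q - move g.2 q') := by
    intro g
    rw [(shapeMap_eq_shapeMap_iff hm q _).2 ⟨g.1, rfl⟩,
      (shapeMap_eq_shapeMap_iff hm q' _).2 ⟨g.2, rfl⟩, shapeMap_eq, shapeMap_eq, massNorm_eq hm]
    refine (hopfDist_le_norm_sub _ _).trans (Real.le_sqrt_of_sq_le ?_)
    rw [map_sub (jacobi m)]
    have := mul_nonneg hM.le (sq_nonneg ‖massCenter m (move g.1 q - move g.2 q')‖)
    linarith
  refine le_antisymm ?_ (le_ciInf hle)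
  obtain ⟨u, hu, h⟩ := exists_hopfDist_eq (jacobi m q) (jacobi m q')
  obtain ⟨g, hg⟩ := exists_rigidMotion hu (massCenter m q - u * massCenter m q')
  obtain ⟨e, he⟩ := exists_rigidMotion (u := 1) (by simp) 0
  refine (ciInf_le ⟨_, forall_mem_range.2 hle⟩ (e, g)).trans ?_
  have hmg : move g q' = fun i => u * q' i + (massCenter m q - u * massCenter m q') :=
    funext fun i => hg (q' i)
  have hme : move e q = q := funext fun i => by simp [move, he (q i)]
  have hd : massNorm m (move e q - move g q') = hopfDist (shapeMap m q) (shapeMap m q') := by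
    rw [massNorm_eq hm, hmg, hme, map_sub, map_sub, jacobi_affine _ _ hm,
      massCenter_affine _ _ hm, shapeMap_eq, shapeMap_eq, h,
      show massCenter m q - (u * massCenter m q' + (massCenter m q - u * massCenter m q')) = 0 by
        ring]
    rw [norm_zero, zero_pow two_ne_zero, mul_zero, zero_add, Real.sqrt_sq (norm_nonneg _)]
  exact hd.le

/-- Orthogonality to translations kills the centre-of-mass velocity; orthogonality to rotation is
`Re ⟨iX,V⟩ = Im ⟨X,V⟩ = 0`, which is independent of the time because `⟨V,V⟩` is real. -/
theorem isHorizontalLine_iff (hm : ∀ i, 0 < m i) (q v : Config) : IsHorizontalLine m q v ↔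
    v ≠ 0 ∧ massCenter m v = 0 ∧ (inner ℂ (jacobi m q) (jacobi m v)).im = 0 := by
  have hM : (0 : ℝ) < m 0 + m 1 + m 2 := add_pos (add_pos (hm 0) (hm 1)) (hm 2)
  have hM' : (m 0 : ℂ) + m 1 + m 2 = ((m 0 + m 1 + m 2 : ℝ) : ℂ) := by push_cast; rfl
  have hone : ∀ c : ℂ, massInner m (fun _ => c) v =
      (m 0 + m 1 + m 2) * (conj c * massCenter m v) := by
    intro c
    have h := massInner_eq hm (fun _ => c) v
    have h1 := jacobi_affine 0 c hm 0
    have h2 := massCenter_affine 0 c hm 0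
    simp only [zero_mul, zero_add, zero_smul] at h1 h2
    rw [h, h1, h2, inner_zero_left, add_zero]
  have hrot : massCenter m v = 0 → ∀ t : ℝ,
      (massInner m (fun i => Complex.I * (q + t • v) i) v).re =
        (inner ℂ (jacobi m q) (jacobi m v)).im := by
    intro hv t
    have h1 := jacobi_affine Complex.I 0 hm (q + t • v)
    simp only [add_zero] at h1
    rw [massInner_eq hm, hv, h1, inner_smul_left, jacobi_add_smul, inner_add_left]
    have h2 : inner ℂ (t • jacobi m v) (jacobi m v) = ((t * ‖jacobi m v‖ ^ 2 : ℝ) : ℂ) := by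
      apply Complex.ext
      · rw [inner_re_E, Complex.ofReal_re, norm_sq_E]; simp; ring
      · rw [inner_im_E, Complex.ofReal_im]; simp; ring
    rw [h2]
    rw [mul_zero, mul_zero, zero_add, mul_add, Complex.add_re, Complex.conj_I, neg_mul, neg_mul,
      Complex.neg_re, Complex.neg_re, Complex.I_mul_re, Complex.I_mul_re, Complex.ofReal_im]
    simp
  refine and_congr_right fun _ => ⟨fun h => ?_, fun ⟨hv, hi⟩ t u hu => ?_⟩
  · have hre := h 0 (fun _ => 1) (Submodule.subset_span (by simp))
    have him := h 0 (fun _ => Complex.I) (Submodule.subset_span (by simp))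
    have hq := h 0 (fun i => Complex.I * (q + (0 : ℝ) • v) i) (Submodule.subset_span (by simp))
    rw [hone, hM', Complex.re_ofReal_mul] at hre him
    have hv : massCenter m v = 0 := by
      apply Complex.ext
      · simpa [hM.ne'] using hre
      · simpa [hM.ne'] using him
    exact ⟨hv, by rw [← hrot hv 0, hq]⟩
  · unfold orbitTangent at hu
    induction hu using Submodule.span_induction with
    | mem x hx =>
      rcases hx with rfl | rfl | rfl
      · rw [hone, hv]; simp
      · rw [hone, hv]; simp
      · rw [hrot hv, hi]
    | zero => simp [massInner]
    | add x y _ _ hx hy =>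
      have : massInner m (x + y) v = massInner m x v + massInner m y v := by
        simp only [massInner, Pi.add_apply, map_add, ← Finset.sum_add_distrib]
        exact Finset.sum_congr rfl fun i _ => by ring
      rw [this, Complex.add_re, hx, hy, add_zero]
    | smul c x _ hx =>
      have : massInner m (c • x) v = c * massInner m x v := by
        simp only [massInner, Pi.smul_apply, Finset.mul_sum, Complex.real_smul, map_mul,
          Complex.conj_ofReal]
        exact Finset.sum_congr rfl fun i _ => by ring
      rw [this, Complex.re_ofReal_mul, hx, mul_zero]

theorem isTripleCollision_iff (hm : ∀ i, 0 < m i) (q : Config) :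
    IsTripleCollision q ↔ jacobi m q = 0 := by
  constructor
  · rintro ⟨h1, h2⟩
    -- A constant triple is an affine image with linear factor `0`.
    have hq : q = fun i => 0 * q i + q 0 := by
      funext i
      fin_cases i <;> simp [h1, h2]
    rw [hq, jacobi_affine _ _ hm, zero_smul]
  · intro h
    have h' : q - (fun _ => massCenter m q) = 0 := by
      have e : q - (fun _ => massCenter m q) = fun i => 1 * q i + -massCenter m q := by
        funext i; simp [sub_eq_add_neg]
      apply eq_zero_of_jacobi_of_massCenter hm
      · rw [e, jacobi_affine _ _ hm, h, smul_zero]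
      · rw [e, massCenter_affine _ _ hm]; ring
    have hq : ∀ i, q i = massCenter m q := fun i => sub_eq_zero.1 (congrFun h' i)
    exact ⟨(hq 0).trans (hq 1).symm, (hq 1).trans (hq 2).symm⟩

/-! ### Geodesics. -/

/-- The distance between the outer images bounds `‖X - Z‖` from below, forcing equality in the
triangle inequality through `Y`; strict convexity makes the two differences positively parallel. -/
theorem eq_of_optimal_lifts {X Y Z : E} {c s m t : ℝ} (hc : 0 < c)
    (hXY : ‖X - Y‖ = c * (m - s)) (hYZ : ‖Y - Z‖ = c * (t - m))
    (hXZ : hopfDist (hopf X) (hopf Z) = c * (t - s)) :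
    (m - s) • (Z - Y) = (t - m) • (Y - X) := by
  have hle := hopfDist_le_norm_sub X Z
  rw [norm_sub_rev] at hXY hYZ
  have hadd : ‖(Y - X) + (Z - Y)‖ = ‖Y - X‖ + ‖Z - Y‖ := by
    refine le_antisymm (norm_add_le _ _) ?_
    rw [hXY, hYZ, show (Y - X) + (Z - Y) = Z - X by abel, norm_sub_rev]
    linarith
  have hray := (sameRay_iff_norm_smul_eq (F := E)).1 (sameRay_iff_norm_add.2 hadd)
  rw [hXY, hYZ, mul_smul, mul_smul] at hray
  exact smul_right_injective E hc.ne' hray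

/-- A curve which realizes the distances on `[a, b]` is there the projection of a horizontal
line. -/
theorem exists_line_of_isometric_Icc {γ : ℝ → W} {c a b : ℝ} (hc : 0 < c) (hab : a < b)
    (h : ∀ s ∈ Icc a b, ∀ t ∈ Icc a b, s ≤ t → hopfDist (γ s) (γ t) = c * (t - s)) :
    ∃ X V : E, V ≠ 0 ∧ (inner ℂ X V).im = 0 ∧ ∀ s ∈ Icc a b, γ s = hopf (X + s • V) := by
  obtain ⟨m, ham, hmb⟩ := exists_between hab
  obtain ⟨Y, hY⟩ := surjective_hopf (γ m)
  -- Lifts are aligned only with `Y`; two of them on opposite sides of `m` are not known in advance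
  -- to be aligned with each other.
  choose Z hZ hYZ using fun s => exists_hopf_eq_and_hopfDist_eq Y (γ s)
  have hm : m ∈ Icc a b := ⟨ham.le, hmb.le⟩
  have haI : a ∈ Icc a b := left_mem_Icc.2 hab.le
  have hbI : b ∈ Icc a b := right_mem_Icc.2 hab.le
  have hl : ∀ s ∈ Icc a b, s ≤ m → ‖Z s - Y‖ = c * (m - s) := fun s hs hsm => by
    rw [norm_sub_rev, ← hYZ, hY, hopfDist_comm, h s hs m hm hsm]
  have hr : ∀ s ∈ Icc a b, m ≤ s → ‖Y - Z s‖ = c * (s - m) := fun s hs hms => by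
    rw [← hYZ, hY, h m hm s hs hms]
  have hal : ∀ s ∈ Icc a b, ∀ t ∈ Icc a b, s < m → m < t →
      (m - s) • (Z t - Y) = (t - m) • (Y - Z s) := fun s hs t ht hsm hmt =>
    eq_of_optimal_lifts hc (hl s hs hsm.le) (hr t ht hmt.le)
      (by rw [hZ, hZ, h s hs t ht (hsm.trans hmt).le])
  have hma : m - a ≠ 0 := (sub_pos.2 ham).ne'
  have hbm : b - m ≠ 0 := (sub_pos.2 hmb).ne'
  set V : E := (m - a)⁻¹ • (Y - Z a) with hV
  have hVb : V = (b - m)⁻¹ • (Z b - Y) := by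
    rw [hV, inv_smul_eq_iff₀ hma, smul_comm, eq_inv_smul_iff₀ hbm, hal a haI b hbI ham hmb]
  have hZs : ∀ s ∈ Icc a b, Z s = Y + (s - m) • V := by
    intro s hs
    rcases lt_trichotomy s m with hsm | rfl | hms
    · have h1 := hal s hs b hbI hsm hmb
      have h2 : Z b - Y = (b - m) • V := by rw [hVb, smul_inv_smul₀ hbm]
      rw [h2, smul_comm] at h1
      have h3 := smul_right_injective E hbm h1
      have h3' : (m - s) • V = Y - Z s := h3
      rw [← neg_sub m s, neg_smul, h3']
      abel
    · have h1 := hl s hs le_rfl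
      rw [sub_self, mul_zero, norm_eq_zero, sub_eq_zero] at h1
      simp [h1]
    · have h1 := hal a haI s hs ham hms
      have h2 : Y - Z a = (m - a) • V := by rw [hV, smul_inv_smul₀ hma]
      rw [h2, smul_comm] at h1
      have h3 : Z s - Y = (s - m) • V := smul_right_injective E hma (by
        simpa only [smul_comm (s - m)] using h1)
      rw [← h3]; abel
  have hV0 : V ≠ 0 := by
    intro hV0
    have h1 := hl a haI ham.le
    rw [hZs a haI, hV0] at h1
    have h2 := mul_pos hc (sub_pos.2 ham)
    rw [← h1] at h2
    simp at h2
  have him : (inner ℂ Y V).im = 0 := by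
    have h1 := inner_im_eq_zero_of_hopfDist_eq (X := Y) (Y := Z b) (by rw [hZ, hYZ])
    rw [hVb]
    generalize (b - m)⁻¹ = k
    rw [inner_im_E] at h1 ⊢
    simp
    linear_combination k * h1
  -- The line passes through `Y` at time `m`, so its base point is moved back to time `0`.
  refine ⟨Y - m • V, V, hV0, ?_, fun s hs => ?_⟩
  · rw [inner_im_E] at him ⊢
    simp
    linear_combination him
  · rw [← hZ s, hZs s hs, sub_smul]
    congr 1
    abel

/-- A curve which realizes the distances on an interval is there the projection of a horizontal
line. -/
theorem exists_line_of_isometric {γ : ℝ → W} {c : ℝ} {I : Set ℝ} (hc : 0 < c)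
    (hI : I.OrdConnected) (hn : I.Nontrivial)
    (h : ∀ s ∈ I, ∀ t ∈ I, s ≤ t → hopfDist (γ s) (γ t) = c * (t - s)) :
    ∃ X V : E, V ≠ 0 ∧ (inner ℂ X V).im = 0 ∧ ∀ s ∈ I, γ s = hopf (X + s • V) := by
  obtain ⟨a, ha, b, hb, hab⟩ := hn.exists_lt
  have hex : ∀ s ∈ I, ∀ t ∈ I, s < t →
      ∃ X V : E, V ≠ 0 ∧ (inner ℂ X V).im = 0 ∧ ∀ r ∈ Icc s t, γ r = hopf (X + r • V) :=
    fun s hs t ht hst => exists_line_of_isometric_Icc hc hst fun x hx y hy hxy =>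
      h x (hI.out hs ht hx) y (hI.out hs ht hy) hxy
  obtain ⟨X, V, hV, hXV, hγ⟩ := hex a ha b hb hab
  refine ⟨X, V, hV, hXV, fun s hs => ?_⟩
  have hmin : min s a ∈ I := by rcases min_choice s a with h | h <;> rwa [h]
  have hmax : max s b ∈ I := by rcases max_choice s b with h | h <;> rwa [h]
  -- The interval is enlarged to contain both `[a, b]` and `s`; the line found there projects as the
  -- first one does.
  obtain ⟨X', V', -, -, hγ'⟩ := hex _ hmin _ hmax
    ((min_le_right s a).trans_lt (hab.trans_le (le_max_right s b)))
  rw [hγ' s ⟨min_le_left _ _, le_max_left _ _⟩]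
  refine hopf_line_unique hab (fun r hr => ?_) s
  rw [← hγ r hr, hγ' r ⟨(min_le_right _ _).trans hr.1, hr.2.trans (le_max_right _ _)⟩]

theorem nontrivial_inter_Ioo {J : Set ℝ} (hJ : J.OrdConnected) (hn : J.Nontrivial) {t ε : ℝ}
    (ht : t ∈ J) (hε : 0 < ε) : (J ∩ Ioo (t - ε) (t + ε)).Nontrivial := by
  obtain ⟨x, hx, hxt⟩ := hn.exists_ne t
  rcases hxt.lt_or_gt with hlt | hlt
  · have h1 : max x (t - ε / 2) < t := max_lt hlt (by linarith)
    exact ⟨t, ⟨ht, by linarith, by linarith⟩, max x (t - ε / 2),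
      ⟨hJ.out hx ht ⟨le_max_left _ _, h1.le⟩, by linarith [le_max_right x (t - ε / 2)],
        by linarith⟩, h1.ne'⟩
  · have h1 : t < min x (t + ε / 2) := lt_min hlt (by linarith)
    exact ⟨t, ⟨ht, by linarith, by linarith⟩, min x (t + ε / 2),
      ⟨hJ.out ht hx ⟨h1.le, min_le_left _ _⟩, by linarith,
        by linarith [min_le_right x (t + ε / 2)]⟩, h1.ne⟩

/-- A geodesic is the projection of a horizontal line, which meets no singular point at interior
times. -/
theorem IsGeodesicOn.exists_line {γ : ℝ → W} {J : Set ℝ} (hJ : J.OrdConnected)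
    (hn : J.Nontrivial) (hγ : IsGeodesicOn γ J) :
    ∃ X V : E, V ≠ 0 ∧ (inner ℂ X V).im = 0 ∧ (∀ t ∈ J, γ t = hopf (X + t • V)) ∧
      ∀ t ∈ interior J, X + t • V ≠ 0 := by
  obtain ⟨c, hc, hγ⟩ := hγ
  have hdist : ∀ t ∈ J, ∃ ε > 0, ∀ s ∈ J ∩ Ioo (t - ε) (t + ε), ∀ s' ∈ J ∩ Ioo (t - ε) (t + ε),
      s ≤ s' → hopfDist (γ s) (γ s') = c * (s' - s) := by
    intro t ht
    obtain ⟨ε, hε, h⟩ := hγ t ht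
    refine ⟨ε, hε, fun s hs s' hs' hss => ?_⟩
    obtain ⟨-, h1, h2⟩ := h s hs.1 s' hs'.1 hs.2.1 hss hs'.2.2
    rw [h1, metricDist_eq, ENNReal.ofReal_eq_ofReal_iff
      (mul_nonneg hc.le (sub_nonneg.2 hss)) (hopfDist_nonneg _ _)] at h2
    exact h2.symm
  have hline : ∀ t : J, ∃ ε > 0, ∃ X V : E, V ≠ 0 ∧ (inner ℂ X V).im = 0 ∧
      ∀ s ∈ J ∩ Ioo (t - ε) (t + ε), γ s = hopf (X + s • V) := by
    rintro ⟨t, ht⟩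
    obtain ⟨ε, hε, h⟩ := hdist t ht
    exact ⟨ε, hε, exists_line_of_isometric hc (hJ.inter ordConnected_Ioo)
      (nontrivial_inter_Ioo hJ hn ht hε) h⟩
  choose ε hε X V hV hXV hline using hline
  obtain ⟨t₀, ht₀⟩ := hn.nonempty
  have huniq : ∀ t u : J, ∀ s : ℝ, hopf (X t + s • V t) = hopf (X u + s • V u) := by
    have : PreconnectedSpace J := Subtype.preconnectedSpace hJ.isPreconnected
    intro t u
    -- Having the same projected line is an equivalence relation that is locally constant on `J`,
    -- hence holds throughout.
    refine isPreconnected_univ.induction₂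
      (fun t u : J => ∀ s : ℝ, hopf (X t + s • V t) = hopf (X u + s • V u)) (fun t _ => ?_)
      (fun x y z _ _ _ h h' s => (h s).trans (h' s)) (fun x y _ _ h s => (h s).symm)
      (mem_univ t) (mem_univ u)
    rw [nhdsWithin_univ]
    have hnh : Subtype.val ⁻¹' Ioo ((t : ℝ) - ε t) (t + ε t) ∈ 𝓝 t :=
      continuous_subtype_val.continuousAt.preimage_mem_nhds
        (Ioo_mem_nhds (by linarith [hε t]) (by linarith [hε t]))
    filter_upwards [hnh] with u hu
    obtain ⟨δ, hδ, hδu⟩ : ∃ δ > 0, Ioo ((u : ℝ) - δ) (u + δ) ⊆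
        Ioo ((t : ℝ) - ε t) (t + ε t) ∩ Ioo ((u : ℝ) - ε u) (u + ε u) := by
      have : Ioo ((t : ℝ) - ε t) (t + ε t) ∩ Ioo ((u : ℝ) - ε u) (u + ε u) ∈ 𝓝 (u : ℝ) :=
        inter_mem (Ioo_mem_nhds hu.1 hu.2) (Ioo_mem_nhds (by linarith [hε u]) (by linarith [hε u]))
      obtain ⟨δ, hδ, h⟩ := Metric.mem_nhds_iff.1 this
      exact ⟨δ, hδ, by rwa [← Real.ball_eq_Ioo]⟩
    obtain ⟨a, ha, b, hb, hab⟩ := (nontrivial_inter_Ioo hJ hn u.2 hδ).exists_lt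
    refine hopf_line_unique hab fun r hr => ?_
    have hrI := (hJ.inter ordConnected_Ioo).out ha hb hr
    rw [← hline t r ⟨hrI.1, (hδu hrI.2).1⟩, ← hline u r ⟨hrI.1, (hδu hrI.2).2⟩]
  have hglob : ∀ t ∈ J, γ t = hopf (X ⟨t₀, ht₀⟩ + t • V ⟨t₀, ht₀⟩) := fun t ht => by
    rw [← huniq ⟨t, ht⟩]
    exact hline ⟨t, ht⟩ t ⟨ht, by linarith [hε ⟨t, ht⟩], by linarith [hε ⟨t, ht⟩]⟩
  refine ⟨_, _, hV ⟨t₀, ht₀⟩, hXV ⟨t₀, ht₀⟩, hglob, fun t ht h0 => ?_⟩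
  obtain ⟨ε', hε', hd⟩ := hdist t (interior_subset ht)
  obtain ⟨δ, hδ, hδJ⟩ := Metric.isOpen_iff.1 isOpen_interior t ht
  rw [Real.ball_eq_Ioo] at hδJ
  -- Symmetric times about a collision have opposite lifts, hence equal images, though a geodesic
  -- must separate them by `2 * c * η`.
  set η := min δ ε' / 2 with hη
  have hη0 : 0 < η := by positivity
  have hηδ : η < δ := by linarith [min_le_left δ ε']
  have hηε : η < ε' := by linarith [min_le_right δ ε']
  have hm1 : t - η ∈ J := interior_subset (hδJ ⟨by linarith, by linarith⟩)
  have hm2 : t + η ∈ J := interior_subset (hδJ ⟨by linarith, by linarith⟩)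
  have h1 := hd (t - η) ⟨hm1, by linarith, by linarith⟩ (t + η) ⟨hm2, by linarith, by linarith⟩
    (by linarith)
  have h2 : γ (t - η) = γ (t + η) := by
    rw [hglob _ hm1, hglob _ hm2]
    have e1 : X ⟨t₀, ht₀⟩ + (t - η) • V ⟨t₀, ht₀⟩ =
        (-1 : ℂ) • (X ⟨t₀, ht₀⟩ + (t + η) • V ⟨t₀, ht₀⟩) := by
      rw [neg_one_smul, sub_smul, add_smul, ← add_sub_assoc, ← add_assoc, h0]
      abel
    rw [e1, hopf_smul (by simp)]
  rw [h2, hopfDist_self] at h1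
  nlinarith [mul_pos hc hη0]

theorem inner_line (X V : E) (s t : ℝ) (h : (inner ℂ X V).im = 0) :
    (inner ℂ (X + s • V) (X + t • V)).im = 0 := by
  rw [inner_im_E] at h ⊢
  simp
  linear_combination (t - s) * h

/-- Projections of horizontal lines are geodesics, away from triple collisions. -/
theorem isGeodesicOn_of_line {γ : ℝ → W} {J : Set ℝ} (hJ : J.OrdConnected) {X V : E}
    (hV : V ≠ 0) (hXV : (inner ℂ X V).im = 0) (hγ : ∀ t ∈ J, γ t = hopf (X + t • V))
    (h0 : ∀ t ∈ interior J, X + t • V ≠ 0) : IsGeodesicOn γ J := by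
  refine ⟨‖V‖, norm_pos_iff.2 hV, fun t ht => ?_⟩
  have hre : ∃ ε > 0, ∀ s ∈ J, ∀ s' ∈ J, t - ε < s → s ≤ s' → s' < t + ε →
      0 ≤ (inner ℂ (X + s • V) (X + s' • V)).re := by
    by_cases hX : X + t • V = 0
    · refine ⟨1, one_pos, fun s hs s' hs' _ _ _ => ?_⟩
      have e : ∀ r : ℝ, X + r • V = (r - t) • V := fun r => by
        rw [eq_neg_of_add_eq_zero_left hX, sub_smul]; abel
      have e' : (inner ℂ (X + s • V) (X + s' • V)).re = (s - t) * (s' - t) * ‖V‖ ^ 2 := by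
        rw [e, e, inner_re_E, norm_sq_E]; simp; ring
      rw [e']
      refine mul_nonneg ?_ (sq_nonneg _)
      by_contra! hneg
      -- A collision can occur only at an endpoint of `J`, so all times lie on the same side of `t`.
      have hmem : ∀ a ∈ J, ∀ b ∈ J, a < t → t < b → False := fun a ha b hb hat htb =>
        h0 t (mem_interior.2 ⟨Ioo a b, Ioo_subset_Icc_self.trans (hJ.out ha hb), isOpen_Ioo,
          hat, htb⟩) hX
      rcases mul_neg_iff.1 hneg with ⟨h1, h2⟩ | ⟨h1, h2⟩
      · exact hmem s' hs' s hs (by linarith) (by linarith)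
      · exact hmem s hs s' hs' (by linarith) (by linarith)
    · have hcont : Continuous fun p : ℝ × ℝ => (inner ℂ (X + p.1 • V) (X + p.2 • V)).re := by
        simp only [inner_re_E, PiLp.add_apply, PiLp.smul_apply, Complex.add_re, Complex.add_im,
          Complex.smul_re, Complex.smul_im]
        fun_prop
      have hpos : 0 < (inner ℂ (X + t • V) (X + t • V)).re := by
        have : (inner ℂ (X + t • V) (X + t • V)).re = ‖X + t • V‖ ^ 2 := by
          rw [inner_re_E, norm_sq_E]; ring
        rw [this]
        exact pow_pos (norm_pos_iff.2 hX) 2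
      have hev := (hcont.tendsto (t, t)).eventually_const_lt hpos
      obtain ⟨ε, hε, h⟩ := Metric.eventually_nhds_iff.1 hev
      refine ⟨ε, hε, fun s hs s' hs' h1 h2 h3 => (h (y := (s, s')) ?_).le⟩
      rw [Prod.dist_eq, max_lt_iff, Real.dist_eq, Real.dist_eq, abs_lt, abs_lt]
      dsimp only
      exact ⟨⟨by linarith, by linarith⟩, ⟨by linarith, by linarith⟩⟩
  obtain ⟨ε, hε, hre⟩ := hre
  refine ⟨ε, hε, fun s hs s' hs' h1 h2 h3 => ?_⟩
  have hγI : ∀ r ∈ Icc s s', γ r = hopf (X + r • V) := fun r hr => hγ r (hJ.out hs hs' hr)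
  have hC : IsPiecewiseC1 γ s s' := isPiecewiseC1_of_contDiffOn h2
    ((contDiff_hopf_line X V).contDiffOn.congr hγI)
  have hd : metricDist (γ s) (γ s') = ENNReal.ofReal (‖V‖ * (s' - s)) := by
    rw [metricDist_eq, hγ s hs, hγ s' hs',
      hopfDist_eq_norm_sub (hre s hs s' hs' h1 h2 h3) (inner_line X V s s' hXV),
      add_sub_add_left_eq_sub, ← sub_smul, norm_smul, Real.norm_eq_abs, abs_sub_comm,
      abs_of_nonneg (sub_nonneg.2 h2), mul_comm]
  have hlen : pathLength γ s s' = ENNReal.ofReal (‖V‖ * (s' - s)) := by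
    refine le_antisymm (pathLength_le_of_eq_hopf_line hγI) ?_
    rw [← hd, metricDist_eq]
    exact hopfDist_le_pathLength hC
  exact ⟨hC, hlen, hlen.trans hd.symm⟩

/-- Through every point passes the projection of a horizontal line. -/
theorem exists_line_through (w : W) (t : ℝ) :
    ∃ X V : E, V ≠ 0 ∧ (inner ℂ X V).im = 0 ∧ hopf (X + t • V) = w := by
  obtain ⟨Y, rfl⟩ := surjective_hopf w
  have hself : ∀ Z : E, (inner ℂ Z Z).im = 0 := fun Z => by rw [inner_im_E]; ring
  by_cases hY : Y = 0
  · obtain ⟨V, hV⟩ := exists_ne (0 : E)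
    refine ⟨-(t • V), V, hV, ?_, by rw [hY, neg_add_cancel]⟩
    have := hself V
    rw [inner_im_E] at this ⊢
    simp
    linear_combination -t * this
  · refine ⟨Y - t • Y, Y, hY, ?_, by rw [sub_add_cancel]⟩
    have := hself Y
    rw [inner_im_E] at this ⊢
    simp
    linear_combination (1 - t) * this

theorem isGeodesicOn_iff_exists_line {γ : ℝ → W} {J : Set ℝ} (hJ : J.OrdConnected) :
    IsGeodesicOn γ J ↔ ∃ X V : E, V ≠ 0 ∧ (inner ℂ X V).im = 0 ∧
      (∀ t ∈ J, γ t = hopf (X + t • V)) ∧ ∀ t ∈ interior J, X + t • V ≠ 0 := by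
  refine ⟨fun h => ?_, fun ⟨X, V, hV, hXV, hγ, h0⟩ => isGeodesicOn_of_line hJ hV hXV hγ h0⟩
  -- On a degenerate interval the geodesic condition determines no line, so one through the given
  -- point, if any, is supplied; the interior is empty.
  rcases J.subsingleton_or_nontrivial with hs | hn
  · rcases hs.eq_empty_or_singleton with rfl | ⟨t, rfl⟩
    · obtain ⟨X, V, hV, hXV, -⟩ := exists_line_through 0 0
      exact ⟨X, V, hV, hXV, by simp, by simp⟩
    · obtain ⟨X, V, hV, hXV, h⟩ := exists_line_through (γ t) t
      exact ⟨X, V, hV, hXV, by simp [h], by simp⟩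
  · exact h.exists_line hJ hn

theorem isGeodesicOn_iff_exists_isHorizontalLine {m : Fin 3 → ℝ} (hm : ∀ i, 0 < m i)
    {γ : ℝ → W} {J : Set ℝ} (hJ : J.OrdConnected) :
    IsGeodesicOn γ J ↔ ∃ q v : Config, IsHorizontalLine m q v ∧
      (∀ t ∈ J, γ t = shapeMap m (q + t • v)) ∧
        ∀ t ∈ interior J, ¬ IsTripleCollision (q + t • v) := by
  simp only [isGeodesicOn_iff_exists_line hJ, isHorizontalLine_iff hm, shapeMap_eq,
    isTripleCollision_iff hm, jacobi_add_smul]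
  constructor
  · rintro ⟨X, V, hV, hXV, hγ, h0⟩
    obtain ⟨q, rfl, -⟩ := exists_jacobi_eq hm X
    obtain ⟨v, rfl, hv⟩ := exists_jacobi_eq hm V
    refine ⟨q, v, ⟨?_, hv, hXV⟩, hγ, h0⟩
    rintro rfl
    simp at hV
  · rintro ⟨q, v, ⟨hv0, hv, hXV⟩, hγ, h0⟩
    exact ⟨_, _, fun h => hv0 (eq_zero_of_jacobi_of_massCenter hm h hv), hXV, hγ, h0⟩

/-! ### Totally geodesic subspaces. -/

/-- Every linear subspace of `ℝ³` is totally geodesic. -/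
theorem isTotallyGeodesic (S : Submodule ℝ W) : IsTotallyGeodesic S := by
  intro J γ hJ hγ t₀ ht₀ hS h0 hd t ht
  rcases J.subsingleton_or_nontrivial with hs | hn
  · rwa [hs ht ht₀]
  obtain ⟨X, V, -, hXV, hline, -⟩ := hγ.exists_line hJ hn
  have huniq : UniqueDiffWithinAt ℝ J t₀ := by
    obtain ⟨a, ha, b, hb, hab⟩ := hn.exists_lt
    exact uniqueDiffWithinAt_convex hJ.convex
      ⟨(a + b) / 2, mem_interior.2 ⟨Ioo a b, Ioo_subset_Icc_self.trans (hJ.out ha hb), isOpen_Ioo,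
        by linarith, by linarith⟩⟩ (subset_closure ht₀)
  have hder : derivWithin γ J t₀ = hopfDeriv (X + t₀ • V) V :=
    ((hasDerivAt_hopf_line X V t₀).hasDerivWithinAt.congr (fun s hs => hline s hs)
      (hline t₀ ht₀)).derivWithin huniq
  rw [hder] at hd
  have him : (inner ℂ (X + t₀ • V) V).im = 0 := by
    rw [inner_im_E] at hXV ⊢
    simp
    linear_combination hXV
  rw [hline t₀ ht₀] at hS h0
  set Y := X + t₀ • V with hY
  have hY0 : ‖Y‖ ^ 2 ≠ 0 := pow_ne_zero 2 (norm_ne_zero_iff.2 fun h => h0 (hopf_eq_zero_iff.2 h))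
  -- Position and velocity are in `S` by hypothesis; horizontality puts the quadratic coefficient
  -- there too.
  have hV : hopf V ∈ S := by
    rw [← S.smul_mem_iff hY0, norm_sq_smul_hopf him]
    exact S.sub_mem (S.smul_mem _ hd) (S.smul_mem _ hS)
  rw [hline t ht, show X + t • V = Y + (t - t₀) • V by rw [hY, sub_smul]; abel, hopf_add_smul]
  exact S.add_mem (S.add_mem hS (S.smul_mem _ hd)) (S.smul_mem _ hV)

/-! ### Polar coordinates on planes through the origin. -/

theorem exists_coord_of_mem_plane {A B C : ℝ} (h : ¬ (A = 0 ∧ B = 0 ∧ C = 0)) {e₁ e₂ w : W}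
    (h₁ : e₁ ∈ plane A B C) (h₂ : e₂ ∈ plane A B C) (n₁ : ‖e₁‖ = 1) (n₂ : ‖e₂‖ = 1)
    (ho : inner ℝ e₁ e₂ = 0) (hw : w ∈ plane A B C) : ∃ x y : ℝ, w = x • e₁ + y • e₂ := by
  have hON : Orthonormal ℝ ![e₁, e₂] := by
    rw [orthonormal_iff_ite]
    intro i j
    fin_cases i <;> fin_cases j <;>
      simp [n₁, n₂, ho, real_inner_comm e₁ e₂]
  have hspan : Submodule.span ℝ (Set.range ![e₁, e₂]) = plane A B C := by
    refine Submodule.eq_of_le_of_finrank_le (Submodule.span_le.2 ?_) ?_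
    · rintro _ ⟨i, rfl⟩
      fin_cases i
      · exact h₁
      · exact h₂
    -- A proper subspace of `ℝ³` has dimension at most two, the dimension of the span; if it were
    -- everything, the standard basis vectors would give `A = B = C = 0`.
    · have htop : plane A B C ≠ ⊤ := fun ht => h ⟨?_, ?_, ?_⟩
      · have hlt := Submodule.finrank_lt htop
        rw [finrank_euclideanSpace_fin] at hlt
        rw [finrank_span_eq_card hON.linearIndependent, Fintype.card_fin]
        omega
      all_goals
        have hmem : ∀ i : Fin 3, EuclideanSpace.single i (1 : ℝ) ∈ plane A B C := fun i => by
          rw [ht]; trivial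
      · simpa [plane] using hmem 0
      · simpa [plane] using hmem 1
      · simpa [plane] using hmem 2
  rw [← hspan, Matrix.range_cons, Matrix.range_cons, Matrix.range_empty, union_empty,
    singleton_union, Submodule.mem_span_pair] at hw
  obtain ⟨x, y, rfl⟩ := hw
  exact ⟨x, y, rfl⟩

theorem inner_orthonormal_pair {e₁ e₂ : W} (n₁ : ‖e₁‖ = 1) (n₂ : ‖e₂‖ = 1)
    (ho : inner ℝ e₁ e₂ = 0)
    (a b c d : ℝ) :
    inner ℝ (a • e₁ + b • e₂) (c • e₁ + d • e₂) = a * c + b * d := by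
  simp only [inner_add_left, inner_add_right, real_inner_smul_left, real_inner_smul_right, ho,
    real_inner_comm e₁ e₂, real_inner_self_eq_norm_sq, n₁, n₂]
  ring

theorem norm_polar {e₁ e₂ : W} (n₁ : ‖e₁‖ = 1) (n₂ : ‖e₂‖ = 1)
    (ho : inner ℝ e₁ e₂ = 0)
    (r θ : ℝ) : ‖polar e₁ e₂ (r, θ)‖ = r ^ 2 / 2 := by
  have h : ‖Real.cos θ • e₁ + Real.sin θ • e₂‖ = 1 := by
    rw [← sq_eq_sq₀ (norm_nonneg _) zero_le_one, ← real_inner_self_eq_norm_sq,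
      inner_orthonormal_pair n₁ n₂ ho]
    nlinarith [Real.sin_sq_add_cos_sq θ]
  rw [polar, norm_smul, h, mul_one, Real.norm_of_nonneg (by positivity)]

theorem polar_injOn {e₁ e₂ : W} (n₁ : ‖e₁‖ = 1) (n₂ : ‖e₂‖ = 1)
    (ho : inner ℝ e₁ e₂ = 0) :
    InjOn (polar e₁ e₂) (Ioi 0 ×ˢ Ico 0 (2 * Real.pi)) := by
  rintro ⟨r, θ⟩ ⟨hr, hθ⟩ ⟨r', θ'⟩ ⟨hr', hθ'⟩ h
  simp only [mem_Ioi] at hr hr'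
  have hn := congrArg norm h
  rw [norm_polar n₁ n₂ ho, norm_polar n₁ n₂ ho] at hn
  obtain rfl : r = r' := by
    rw [← sq_eq_sq₀ (le_of_lt hr) (le_of_lt hr')]; linarith
  have h' := smul_right_injective W (by positivity : r ^ 2 / 2 ≠ 0) h
  have hc := congrArg (fun w => inner ℝ w ((1 : ℝ) • e₁ + (0 : ℝ) • e₂)) h'
  have hs := congrArg (fun w => inner ℝ w ((0 : ℝ) • e₁ + (1 : ℝ) • e₂)) h'
  simp only [inner_orthonormal_pair n₁ n₂ ho, mul_one, mul_zero, add_zero, zero_add] at hc hs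
  have hang : (θ : Real.Angle) = θ' := Real.Angle.cos_sin_inj hc hs
  obtain ⟨k, hk⟩ := Real.Angle.angle_eq_iff_two_pi_dvd_sub.1 hang
  have hpi := Real.two_pi_pos
  have hk0 : k = 0 := by
    have h1 : (-1 : ℝ) < k := by
      by_contra! hle
      nlinarith [hθ.1, hθ.2, hθ'.1, hθ'.2]
    have h2 : (k : ℝ) < 1 := by
      by_contra! hle
      nlinarith [hθ.1, hθ.2, hθ'.1, hθ'.2]
    have h1' : -1 < k := by exact_mod_cast h1
    have h2' : k < 1 := by exact_mod_cast h2
    omega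
  rw [hk0, Int.cast_zero, mul_zero, sub_eq_zero] at hk
  rw [hk]

theorem exists_polar_eq {e₁ e₂ : W} {x y : ℝ} (h : x • e₁ + y • e₂ ≠ 0) :
    ∃ p ∈ Ioi (0 : ℝ) ×ˢ Ico 0 (2 * Real.pi), polar e₁ e₂ p = x • e₁ + y • e₂ := by
  set z : ℂ := ⟨x, y⟩ with hz
  have hz0 : z ≠ 0 := by
    intro h0
    have hx : x = 0 := congrArg Complex.re h0
    have hy : y = 0 := congrArg Complex.im h0
    simp [hx, hy] at h
  have hn : 0 < ‖z‖ := norm_pos_iff.2 hz0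
  have hpi := Real.two_pi_pos
  obtain ⟨k, hk⟩ : ∃ k : ℤ, toIcoMod hpi 0 z.arg = z.arg - k * (2 * Real.pi) :=
    ⟨toIcoDiv hpi 0 z.arg, by rw [toIcoMod, zsmul_eq_mul]⟩
  have hmem := toIcoMod_mem_Ico hpi 0 z.arg
  -- The complex argument takes values in `(-π, π]` and is reduced to `[0, 2π)`; the radius inverts
  -- `‖w‖ = r ^ 2 / 2`.
  refine ⟨(√(2 * ‖z‖), toIcoMod hpi 0 z.arg), ⟨by simp [hn], by simpa using hmem⟩, ?_⟩
  simp only [polar]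
  rw [hk, Real.cos_sub_int_mul_two_pi, Real.sin_sub_int_mul_two_pi, Real.sq_sqrt (by positivity),
    mul_div_cancel_left₀ _ two_ne_zero, smul_add, smul_smul, smul_smul, Complex.norm_mul_cos_arg,
    Complex.norm_mul_sin_arg]

theorem polar_bijOn {e₁ e₂ : W} (n₁ : ‖e₁‖ = 1) (n₂ : ‖e₂‖ = 1)
    (ho : inner ℝ e₁ e₂ = 0) {A B C : ℝ} (h : ¬ (A = 0 ∧ B = 0 ∧ C = 0)) (h₁ : e₁ ∈ plane A B C)
    (h₂ : e₂ ∈ plane A B C) :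
    BijOn (polar e₁ e₂) (Ioi 0 ×ˢ Ico 0 (2 * Real.pi)) ((plane A B C : Set W) \ {0}) := by
  refine ⟨?_, polar_injOn n₁ n₂ ho, ?_⟩
  · rintro ⟨r, θ⟩ ⟨hr, -⟩
    refine ⟨Submodule.smul_mem _ _ (Submodule.add_mem _ (Submodule.smul_mem _ _ h₁)
      (Submodule.smul_mem _ _ h₂)), fun h0 => ?_⟩
    have hn := norm_polar n₁ n₂ ho r θ
    rw [mem_singleton_iff.1 h0, norm_zero] at hn
    have hr' : 0 < r := hr
    have := pow_pos hr' 2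
    linarith
  · rintro w ⟨hw, hw0⟩
    obtain ⟨x, y, rfl⟩ := exists_coord_of_mem_plane h h₁ h₂ n₁ n₂ ho hw
    exact exists_polar_eq hw0

theorem metricDist_zero_polar {e₁ e₂ : W} (n₁ : ‖e₁‖ = 1) (n₂ : ‖e₂‖ = 1)
    (ho : inner ℝ e₁ e₂ = 0) {r : ℝ} (hr : 0 < r) (θ : ℝ) :
    metricDist 0 (polar e₁ e₂ (r, θ)) = ENNReal.ofReal r := by
  rw [metricDist_eq, hopfDist_zero_left, norm_polar n₁ n₂ ho, mul_div_cancel₀ _ two_ne_zero,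
    Real.sqrt_sq hr.le]

theorem fderiv_polar {e₁ e₂ : W} (r θ : ℝ) (x : ℝ × ℝ) :
    fderiv ℝ (polar e₁ e₂) (r, θ) x =
    (r * x.1 * Real.cos θ - r ^ 2 / 2 * x.2 * Real.sin θ) • e₁ +
      (r * x.1 * Real.sin θ + r ^ 2 / 2 * x.2 * Real.cos θ) • e₂ := by
  have hr : HasFDerivAt (fun p : ℝ × ℝ => p.1) (ContinuousLinearMap.fst ℝ ℝ ℝ) (r, θ) :=
    hasFDerivAt_fst
  have hθ : HasFDerivAt (fun p : ℝ × ℝ => p.2) (ContinuousLinearMap.snd ℝ ℝ ℝ) (r, θ) :=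
    hasFDerivAt_snd
  have h := ((hr.pow 2).mul_const (1 / 2)).smul
    ((hθ.cos.smul_const e₁).add (hθ.sin.smul_const e₂))
  have hp : polar e₁ e₂ = fun p : ℝ × ℝ =>
      (p.1 ^ 2 * (1 / 2)) • (Real.cos p.2 • e₁ + Real.sin p.2 • e₂) := by
    funext p
    rw [polar, div_eq_mul_one_div]
  rw [hp]
  refine (congrArg (fun L : ℝ × ℝ →L[ℝ] W => L x) h.fderiv).trans ?_
  simp only [Pi.add_apply, nsmul_eq_mul, Nat.cast_ofNat, Nat.add_one_sub_one, pow_one,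
    add_apply, smul_apply,
    ContinuousLinearMap.smulRight_apply, ContinuousLinearMap.coe_fst',
    ContinuousLinearMap.coe_snd', smul_eq_mul]
  module

theorem shapeMetric_polar {e₁ e₂ : W} (n₁ : ‖e₁‖ = 1) (n₂ : ‖e₂‖ = 1)
    (ho : inner ℝ e₁ e₂ = 0) {r : ℝ} (hr : 0 < r) (θ : ℝ) (x y : ℝ × ℝ) :
    shapeMetric (polar e₁ e₂ (r, θ)) (fderiv ℝ (polar e₁ e₂) (r, θ) x)
      (fderiv ℝ (polar e₁ e₂) (r, θ) y) = x.1 * y.1 + 1 / 4 * r ^ 2 * (x.2 * y.2) := by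
  rw [shapeMetric, fderiv_polar, fderiv_polar, inner_orthonormal_pair n₁ n₂ ho,
    norm_polar n₁ n₂ ho, div_eq_iff (by positivity)]
  linear_combination (r ^ 2 * x.1 * y.1 + r ^ 4 / 4 * x.2 * y.2) * Real.sin_sq_add_cos_sq θ

end ShapeSpace

end

theorem mainTheorem2 (m : Fin 3 → ℝ) (hm : ∀ i, 0 < m i) :
    -- the projection identifies shape space with `ℝ³`
    (Function.Surjective (ShapeSpace.shapeMap m) ∧
      ∀ q q' : ShapeSpace.Config, ShapeSpace.shapeMap m q = ShapeSpace.shapeMap m q' ↔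
        ∃ g : ShapeSpace.rigidMotions, ShapeSpace.move g q = q') ∧
    -- the Riemannian distance is the shape space distance
    (∀ q q' : ShapeSpace.Config,
      ShapeSpace.metricDist (ShapeSpace.shapeMap m q) (ShapeSpace.shapeMap m q') =
        ENNReal.ofReal (ShapeSpace.shapeDist m q q')) ∧
    -- the geodesics are the projections of horizontal lines
    (∀ (J : Set ℝ) (γ : ℝ → ShapeSpace.W), J.OrdConnected →
      (ShapeSpace.IsGeodesicOn γ J ↔
        ∃ q v : ShapeSpace.Config, ShapeSpace.IsHorizontalLine m q v ∧
          (∀ t ∈ J, γ t = ShapeSpace.shapeMap m (q + t • v)) ∧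
          ∀ t ∈ interior J, ¬ ShapeSpace.IsTripleCollision (q + t • v))) ∧
    -- planes through the origin
    (∀ A B C : ℝ, ¬ (A = 0 ∧ B = 0 ∧ C = 0) →
      ShapeSpace.IsTotallyGeodesic (ShapeSpace.plane A B C) ∧
      ∀ e₁ ∈ ShapeSpace.plane A B C, ∀ e₂ ∈ ShapeSpace.plane A B C,
        ‖e₁‖ = 1 → ‖e₂‖ = 1 → inner ℝ e₁ e₂ = 0 →
          -- `(r, θ)` are polar coordinates on the plane, `r` being the distance to the origin
          Set.BijOn (ShapeSpace.polar e₁ e₂) (Set.Ioi 0 ×ˢ Set.Ico 0 (2 * Real.pi))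
            ((ShapeSpace.plane A B C : Set ShapeSpace.W) \ {0}) ∧
          ∀ r θ : ℝ, 0 < r →
            ShapeSpace.metricDist 0 (ShapeSpace.polar e₁ e₂ (r, θ)) = ENNReal.ofReal r ∧
            -- the restricted metric is `dr² + r² dθ² / 4`
            ∀ x y : ℝ × ℝ,
              ShapeSpace.shapeMetric (ShapeSpace.polar e₁ e₂ (r, θ))
                  (fderiv ℝ (ShapeSpace.polar e₁ e₂) (r, θ) x)
                  (fderiv ℝ (ShapeSpace.polar e₁ e₂) (r, θ) y) =
                x.1 * y.1 + 1 / 4 * r ^ 2 * (x.2 * y.2)) := by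
  refine ⟨⟨ShapeSpace.surjective_shapeMap hm, ShapeSpace.shapeMap_eq_shapeMap_iff hm⟩,
    fun q q' => ?_, fun J γ hJ => ShapeSpace.isGeodesicOn_iff_exists_isHorizontalLine hm hJ,
    fun A B C h => ⟨ShapeSpace.isTotallyGeodesic _, fun e₁ h₁ e₂ h₂ n₁ n₂ ho =>
      ⟨ShapeSpace.polar_bijOn n₁ n₂ ho h h₁ h₂, fun r θ hr =>
        ⟨ShapeSpace.metricDist_zero_polar n₁ n₂ ho hr θ,
          ShapeSpace.shapeMetric_polar n₁ n₂ ho hr θ⟩⟩⟩⟩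
  rw [ShapeSpace.metricDist_eq, ShapeSpace.shapeDist_eq hm]
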